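/- **Model.** There are $M$ dispatchers and $N$ servers, in discrete time. The state at the beginning of slot $t$ is $Z(t)=(\mathbf Q(t),(\widetilde Q^m_n(t))_{m,n})$, where $Q_n\in\mathbb N$ is the queue length of server $n$ and $\widetilde Q^m_n\in\mathbb N$ is the estimate of it held by dispatcher $m$; $Z(0)=0$. In each slot: * $A^m(t)\in\mathbb N$ tasks arrive at dispatcher $m$. The vectors $(A^1(t),\dots,A^M(t))$ are i.i.d. in $t$ and independent of the state. With $A_\Sigma=\sum_m A^m$ we assume $\mathbb P(A_\Sigma=0)>0$ and $\mathbb P(A^m>0)\ge p_0$ for all $m$ and some $p_0>0$. * Each dispatcher $m$ sends all its arrivals to one server, chosen to be $n$ with a probability $P^m_n$ that depends only on its own estimates $\widetilde{\mathbf Q}^m(t)$, independently over $m$ and independently of arrivals and services. Let $A^m_n(t)$ be the number of tasks sent from $m$ to $n$, and $A_n=\sum_mA^m_n$. * Server $n$ offers service $S_n(t)\in\mathbb N$, i.i.d. in $t$, independent over $n$ and of the arrivals, with mean $\mu_n>0$; $\mu_\Sigma=\sum_n\mu_n$. Then $Q_n(t+1)=Q_n(t)+A_n(t)-S_n(t)+U_n(t)$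 with $U_n(t)=\max\{S_n(t)-Q_n(t)-A_n(t),0\}$. * Finally the update strategy decides at random, possibly depending on $Z(t)$ and on the arrivals, choices and services of the slot, for which $(m,n)$ the estimate is synchronized ($\mathcal I^m_n(t)=1$), that is, $\widetilde Q^m_n(t+1)=Q_n(t+1)$. If $\mathcal I^m_n(t)=0$, then $\widetilde Q^m_n(t)\le\widetilde Q^m_n(t+1)\le\widetilde Q^m_n(t)+A^m_n(t)$. The state space $\mathcal Z$ of the Markov chain $Z$ consists of the states that can be reached from $0$. A steady state is a stationary distribution on $\mathcal Z$, and $\overline{\mathbf Q}$ denotes the queue vector under it. Write $\mathbf Q_\perp=\mathbf Q-\langle\mathbf Q,\mathbf c\rangle\mathbf c$ with $\mathbf c=\frac1{\sqrt N}(1,\dots,1)$, and let $\|\cdot\|$ be the Euclidean norm. The dispatching strategy of dispatcher $m$ is *$\delta$-tilted* if there is $k\in\{2,\dots,N\}$ such that for every state in $\mathcal Z$ there is a permutation $\sigma$ with $\widetilde Q^m_{\sigma(1)}\le\dots\le\widetilde Q^m_{\sigma(N)}$ for which $\Delta_n=P^m_{\sigma(n)}-\mu_{\sigma(n)}/\mu_\Sigma$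 satisfies $\Delta_n\ge0$ for $n<k$, $\Delta_n\le0$ for $n\ge k$, $\Delta_1\ge\delta$ and $\Delta_N\le-\delta$. **Proposition.** Fix $M$, $N$, the laws of the services $S_n$ (with $\mu_n>0$) and constants $\theta_1,\theta_2,\delta,p>0$ and $D_1,D_2$ such that $\mathbb E[e^{\theta_2S_n}]\le D_2$ for all $n$. Then there are $\epsilon_0>0$ and finite constants $L_r$, $r\in\mathbb N$, such that the following holds for every $\epsilon\in(0,\epsilon_0)$ and every system as above with $\mathbb E[A_\Sigma]=\mu_\Sigma-\epsilon$ and $\mathbb E[e^{\theta_1A_\Sigma}]\le D_1$, in which the dispatching strategy of every dispatcher is $\delta$-tilted and $\mathbb E[\mathcal I^m_n(t)\mid Z(t)=Z]\ge p$ for all $Z\in\mathcal Z$ and all $m,n$: a steady state exists, and in every steady state $$\mathbb E\big[\|\overline{\mathbf Q}_\perp\|^r\big]\le L_r\qquad\text{for all } r\in\mathbb N.$$ In particular the constants $L_r$ do not depend on $\epsilon$. -/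

import Mathlib

open scoped ENNReal

namespace LED

noncomputable section

/-- Expectation of a nonnegative, possibly infinite, function under a discrete law. -/
def expect {α : Type*} (P : PMF α) (f : α → ℝ≥0∞) : ℝ≥0∞ := ∑' x, P x * f x

/-- The law of a vector of independent coordinates, the `i`-th one having law `P i`. -/
def indep {ι α : Type*} [Fintype ι] [Countable α] (P : ι → PMF α) : PMF (ι → α) :=
  letI : MeasurableSpace α := ⊤
  (MeasureTheory.Measure.pi fun i => (P i).toMeasure).toPMF

/-- Mean service rate `μ_n`, for the laws `service n` of the offered service `S_n(t)`. -/
def serviceRate {N : ℕ} (service : Fin N → PMF ℕ) (n : Fin N) : ℝ :=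
  (expect (service n) fun s => (s : ℝ≥0∞)).toReal

/-- Total mean service rate `μ_Σ`. -/
def totalServiceRate {N : ℕ} (service : Fin N → PMF ℕ) : ℝ :=
  ∑ n, serviceRate service n

/-- Mean rate `λ_Σ` of the total arrivals, for the law of the vector
`(A^1(t), …, A^M(t))` of arrivals at the dispatchers in one slot. -/
def totalArrivalRate {M : ℕ} (arrival : PMF (Fin M → ℕ)) : ℝ :=
  (expect arrival fun a => ((∑ m, a m : ℕ) : ℝ≥0∞)).toReal

/-- State `Z = (Q, m)`: the queue lengths `Q_n` and the local estimates `Q̃^m_n`. -/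
structure State (M N : ℕ) where
  queue : Fin N → ℕ
  est : Fin M → Fin N → ℕ

/-- The empty system, in which all estimates are zero as well. -/
def State.init (M N : ℕ) : State M N := ⟨fun _ => 0, fun _ _ => 0⟩

/-- `A^m_n`: tasks sent by dispatcher `m` to server `n`, if `a` are the arrivals at the
dispatchers and `d m` is the server chosen by dispatcher `m`. -/
def sent {M N : ℕ} (a : Fin M → ℕ) (d : Fin M → Fin N) (m : Fin M) (n : Fin N) : ℕ :=
  if d m = n then a m else 0

/-- `A_n`: all the tasks routed to server `n`. -/
def routed {M N : ℕ} (a : Fin M → ℕ) (d : Fin M → Fin N) (n : Fin N) : ℕ :=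
  ∑ m, sent a d m n

/-- What the update strategy decides at the end of a slot: `sync m n` says whether the
estimate of server `n` at dispatcher `m` is set to the true queue length; if it is not,
then `incr m n` is added to it. -/
structure UpdateDecision (M N : ℕ) where
  sync : Fin M → Fin N → Bool
  incr : Fin M → Fin N → ℕ

/-- A local-estimation-driven policy. Dispatcher `m` chooses one server at random with a law
that depends only on its own estimates. The update decision is random and may depend on the
state at the beginning of the slot and on the arrivals, choices and offered services of the
slot. An estimate that is not synchronized does not decrease, and it grows by at most the
number of tasks that the dispatcher itself has just sent to this server. -/
structure Policy (M N : ℕ) where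
  dispatch : Fin M → (Fin N → ℕ) → PMF (Fin N)
  update : State M N → (Fin M → ℕ) → (Fin M → Fin N) → (Fin N → ℕ) →
    PMF (UpdateDecision M N)
  incr_le : ∀ z a d s, ∀ u ∈ (update z a d s).support, ∀ m n, u.incr m n ≤ sent a d m n

/-- Everything that happens in one slot: arrivals at the dispatchers, chosen servers, offered
services, update decision. -/
structure Slot (M N : ℕ) where
  arr : Fin M → ℕ
  choice : Fin M → Fin N
  serv : Fin N → ℕ
  upd : UpdateDecision M N

/-- Unused service `U_n = max (S_n - Q_n - A_n) 0` (subtraction in `ℕ` truncates at zero). -/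
def unused {M N : ℕ} (z : State M N) (w : Slot M N) (n : Fin N) : ℕ :=
  w.serv n - (z.queue n + routed w.arr w.choice n)

/-- Queue dynamics `Q_n(t+1) = Q_n(t) + A_n(t) - S_n(t) + U_n(t)`; the subtraction never
truncates. -/
def nextQueue {M N : ℕ} (z : State M N) (w : Slot M N) (n : Fin N) : ℕ :=
  z.queue n + routed w.arr w.choice n + unused z w n - w.serv n

/-- The state at the beginning of the next slot. -/
def nextState {M N : ℕ} (z : State M N) (w : Slot M N) : State M N where
  queue := nextQueue z w
  est m n := if w.upd.sync m n then nextQueue z w n else z.est m n + w.upd.incr m n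

/-- Law of the events of one slot given the state `z` at its beginning: arrivals, choices of
the dispatchers and services are independent, then the update strategy acts. -/
def slotLaw {M N : ℕ} (arrival : PMF (Fin M → ℕ)) (service : Fin N → PMF ℕ)
    (pol : Policy M N) (z : State M N) : PMF (Slot M N) :=
  arrival.bind fun a =>
    (indep fun m => pol.dispatch m (z.est m)).bind fun d =>
      (indep service).bind fun s =>
        (pol.update z a d s).map fun u => ⟨a, d, s, u⟩

/-- One-step transition law of the Markov chain `Z(t)`. -/
def transition {M N : ℕ} (arrival : PMF (Fin M → ℕ)) (service : Fin N → PMF ℕ)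
    (pol : Policy M N) (z : State M N) : PMF (State M N) :=
  (slotLaw arrival service pol z).map (nextState z)

/-- The state space of the chain: the states that can be reached from the empty system. -/
def Reachable {M N : ℕ} (arrival : PMF (Fin M → ℕ)) (service : Fin N → PMF ℕ)
    (pol : Policy M N) (z : State M N) : Prop :=
  Relation.ReflTransGen (fun x y => y ∈ (transition arrival service pol x).support)
    (State.init M N) z

/-- `π` is a stationary distribution of the chain on its state space. -/
def IsSteadyState {M N : ℕ} (arrival : PMF (Fin M → ℕ)) (service : Fin N → PMF ℕ)
    (pol : Policy M N) (π : PMF (State M N)) : Prop :=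
  (∀ z ∈ π.support, Reachable arrival service pol z) ∧
    π.bind (transition arrival service pol) = π

/-- Standing assumptions on the arrivals of a system with parameter `ε`: the total arrival
rate is `μ_Σ - ε`, the total arrivals are light-tailed with constants `θ₁`, `D₁`, they vanish
with positive probability, and every dispatcher receives tasks with positive probability. -/
structure IsArrivalLaw {M N : ℕ} (service : Fin N → PMF ℕ) (θ₁ D₁ ε : ℝ)
    (arrival : PMF (Fin M → ℕ)) : Prop where
  rate : totalArrivalRate arrival = totalServiceRate service - ε
  light_tail :
    expect arrival (fun a => ENNReal.ofReal (Real.exp (θ₁ * ((∑ m, a m : ℕ) : ℝ))))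
      ≤ ENNReal.ofReal D₁
  zero_pos : 0 < expect arrival (fun a => if ∑ m, a m = 0 then 1 else 0)
  dispatcher_pos : ∃ p₀ : ℝ≥0∞, 0 < p₀ ∧
    ∀ m, p₀ ≤ expect arrival (fun a => if 0 < a m then 1 else 0)

/-- Dispatching preference `Δ_i = P_{σ(i)} - μ_{σ(i)} / μ_Σ` for the choice law `P` and the
ordering `σ` of the servers. Positions `i : Fin N` are counted from zero. -/
def preference {N : ℕ} (service : Fin N → PMF ℕ) (P : PMF (Fin N))
    (σ : Equiv.Perm (Fin N)) (i : Fin N) : ℝ :=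
  (P (σ i)).toReal - serviceRate service (σ i) / totalServiceRate service

/-- The dispatching strategy of dispatcher `m` is `δ`-tilted: there is `k ∈ {2, …, N}` such
that in every state of the chain, with the servers ordered by increasing estimates, the
preference is nonnegative at the (one-based) positions before `k`, nonpositive from position
`k` on, at least `δ` at the first position and at most `-δ` at the last one. -/
def IsDeltaTilted {M N : ℕ} (arrival : PMF (Fin M → ℕ)) (service : Fin N → PMF ℕ)
    (pol : Policy M N) (δ : ℝ) (m : Fin M) : Prop :=
  ∃ k : ℕ, 2 ≤ k ∧ k ≤ N ∧ ∀ z, Reachable arrival service pol z →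
    ∃ σ : Equiv.Perm (Fin N), Monotone (z.est m ∘ σ) ∧
      ∀ i : Fin N,
        ((i : ℕ) + 1 < k → 0 ≤ preference service (pol.dispatch m (z.est m)) σ i) ∧
        (k ≤ (i : ℕ) + 1 → preference service (pol.dispatch m (z.est m)) σ i ≤ 0) ∧
        ((i : ℕ) + 1 = 1 → δ ≤ preference service (pol.dispatch m (z.est m)) σ i) ∧
        ((i : ℕ) + 1 = N → preference service (pol.dispatch m (z.est m)) σ i ≤ -δ)

/-- In every state of the chain, each estimate at each dispatcher is synchronized at the end
of the slot with conditional probability at least `p`. -/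
def UpdatesWithProb {M N : ℕ} (arrival : PMF (Fin M → ℕ)) (service : Fin N → PMF ℕ)
    (pol : Policy M N) (p : ℝ) : Prop :=
  ∀ z, Reachable arrival service pol z → ∀ (m : Fin M) (n : Fin N),
    ENNReal.ofReal p ≤
      expect (slotLaw arrival service pol z) (fun w => if w.upd.sync m n then 1 else 0)

/-- The queue length vector in Euclidean space. -/
def queueVec {M N : ℕ} (z : State M N) : EuclideanSpace ℝ (Fin N) :=
  WithLp.toLp 2 fun n => (z.queue n : ℝ)

/-- The unit vector `c = (1, …, 1) / √N`. -/
def diagDir (N : ℕ) : EuclideanSpace ℝ (Fin N) :=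
  WithLp.toLp 2 fun _ => 1 / Real.sqrt N

/-- `Q_⊥ = Q - ⟨Q, c⟩ c`. -/
def queuePerp {M N : ℕ} (z : State M N) : EuclideanSpace ℝ (Fin N) :=
  queueVec z - inner ℝ (queueVec z) (diagDir N) • diagDir N

end

end LED

/-! The distance of the queues from the diagonal has a negative drift whose strength comes from the
tilt `δ`, not from the slack `ε`. With exact estimates, a tilted choice contributes to the
conditional mean of `⟨Q_⊥, A - S⟩` a term of order `-δ μ_Σ (max Q - min Q)`, and this spread
dominates `‖Q_⊥‖` up to a factor `N`. The slack costs at most `ε` times the spread, which is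
absorbed when `ε` is small compared with `δ μ_Σ`. Inexact estimates cost a multiple of the total
estimation error. Each error is erased with probability at least `p` and otherwise grows by at most
the load of the slot, whose moments are bounded uniformly in `ε`.

Hence `‖Q_⊥‖^(2t+2) + K ∑ |Q - Q̃|^(2t+1)` has drift at most `C - η ‖Q_⊥‖^(2t+1)`, with `K`, `η`,
`C` chosen before `ε`, the arrivals and the policy (`exists_perp_drift`). The exponents match
because Young's inequality splits the cross term `‖Q_⊥‖^(2t) |Q - Q̃|` into two powers of order
`2t+1`. A truncation argument (`expect_stationary_le`) turns the drift into a moment bound for every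
steady state.

Existence uses the function `∑ Q² + K ∑ |Q - Q̃|`, whose drift comes from the slack
(`exists_queue_drift`), so its constants may depend on `ε`. Tightness of the occupation frequencies
then gives a stationary law (`exists_stationary`). -/

namespace LED

open MeasureTheory Filter Topology

/-! ### Calculus of expectations under discrete laws. -/

section Expectation

variable {α β : Type*}

theorem expect_mono (P : PMF α) {f g : α → ℝ≥0∞} (h : ∀ x ∈ P.support, f x ≤ g x) :
    expect P f ≤ expect P g := by
  refine ENNReal.tsum_le_tsum fun x => ?_
  by_cases hx : P x = 0
  · simp [hx]
  · exact mul_le_mul_right (h x ((P.mem_support_iff x).2 hx)) _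

theorem expect_const (P : PMF α) (c : ℝ≥0∞) : expect P (fun _ => c) = c := by
  simp [expect, ENNReal.tsum_mul_right, P.tsum_coe]

theorem expect_add (P : PMF α) (f g : α → ℝ≥0∞) :
    expect P (fun x => f x + g x) = expect P f + expect P g := by
  simp [expect, mul_add, ENNReal.tsum_add]

theorem expect_const_mul (P : PMF α) (c : ℝ≥0∞) (f : α → ℝ≥0∞) :
    expect P (fun x => c * f x) = c * expect P f := by
  simp only [expect, ← ENNReal.tsum_mul_left]
  exact tsum_congr fun x => by ring

theorem expect_finset_sum {ι : Type*} (P : PMF α) (s : Finset ι) (f : ι → α → ℝ≥0∞) :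
    expect P (fun x => ∑ i ∈ s, f i x) = ∑ i ∈ s, expect P (f i) := by
  classical
  induction s using Finset.induction_on with
  | empty => simp [expect]
  | insert i s hi ih => simp [Finset.sum_insert hi, expect_add, ih]

theorem expect_pure (x : α) (f : α → ℝ≥0∞) : expect (PMF.pure x) f = f x := by
  rw [expect, tsum_eq_single x]
  · simp
  · intro y hy
    simp [hy]

theorem expect_bind (P : PMF α) (T : α → PMF β) (f : β → ℝ≥0∞) :
    expect (P.bind T) f = expect P (fun x => expect (T x) f) := by
  simp only [expect, PMF.bind_apply, ← ENNReal.tsum_mul_right, ← ENNReal.tsum_mul_left]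
  rw [ENNReal.tsum_comm]
  exact tsum_congr fun x => tsum_congr fun y => by ring

theorem expect_map (P : PMF α) (g : α → β) (f : β → ℝ≥0∞) :
    expect (P.map g) f = expect P (fun x => f (g x)) := by
  rw [← PMF.bind_pure_comp, expect_bind]
  simp [expect_pure]

theorem expect_eq_lintegral [Countable α] [MeasurableSpace α] [MeasurableSingletonClass α]
    (P : PMF α) (f : α → ℝ≥0∞) : expect P f = ∫⁻ x, f x ∂P.toMeasure := by
  rw [lintegral_countable']
  refine tsum_congr fun x => ?_
  rw [P.toMeasure_apply_singleton x (measurableSet_singleton x), mul_comm]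

theorem expect_indep_coord {ι : Type*} [Fintype ι] [Countable α] (P : ι → PMF α) (i : ι)
    (g : α → ℝ≥0∞) : expect (indep P) (fun x => g (x i)) = expect (P i) g := by
  let _ : MeasurableSpace α := ⊤
  rw [expect_eq_lintegral, expect_eq_lintegral]
  have h : (indep P).toMeasure = Measure.pi fun i => (P i).toMeasure :=
    Measure.toPMF_toMeasure _
  rw [h]
  exact (measurePreserving_eval (fun i => (P i).toMeasure) i).lintegral_comp
    (f := g) (measurable_from_top)

/-- Both masses sum to one, so no strict inequality is possible. This reduces stationarity of a
limit law to a one-sided inequality. -/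
theorem pmf_eq_of_le {P Q : PMF α} (h : ∀ x, P x ≤ Q x) : P = Q := by
  ext x
  by_contra hne
  have hlt : P x < Q x := lt_of_le_of_ne (h x) hne
  have := ENNReal.tsum_lt_tsum (f := P) (g := Q) (by simp [P.tsum_coe]) h hlt
  simp [P.tsum_coe, Q.tsum_coe] at this

end Expectation

/-! ### Drift inequalities on a countable state space: stationary bounds and existence. -/

section MarkovChain

variable {X : Type*}

/-- Law at time `t` of the chain with kernel `T` started at `x`. -/
noncomputable def lawAt (T : X → PMF X) (x : X) : ℕ → PMF X
  | 0 => PMF.pure x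
  | t + 1 => (lawAt T x t).bind T

theorem bind_lawAt {T : X → PMF X} {π : PMF X} (hπ : π.bind T = π) (t : ℕ) :
    π.bind (fun x => lawAt T x t) = π := by
  induction t with
  | zero => exact PMF.bind_pure π
  | succ t ih =>
    change π.bind (fun x => (lawAt T x t).bind T) = π
    rw [← PMF.bind_bind, ih, hπ]

theorem lawAt_support {T : X → PMF X} {R : X → Prop}
    (hR : ∀ x, R x → ∀ y ∈ (T x).support, R y) {x : X} (hx : R x) (t : ℕ) :
    ∀ y ∈ (lawAt T x t).support, R y := by
  induction t with
  | zero =>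
    intro y hy
    have : y = x := by simpa [lawAt] using hy
    exact this ▸ hx
  | succ t ih =>
    intro y hy
    obtain ⟨z, hz, hzy⟩ := (PMF.mem_support_bind_iff _ _ _).1 hy
    exact hR z (ih z hz) y hzy

variable {T : X → PMF X} {R : X → Prop} {V f : X → ℝ≥0∞} {C : ℝ≥0∞}

/-- The drift inequality telescopes along the chain; additive form avoids subtraction of possibly
infinite quantities. -/
theorem expect_lawAt_add_sum_le (hR : ∀ x, R x → ∀ y ∈ (T x).support, R y)
    (hdrift : ∀ x, R x → expect (T x) V + f x ≤ V x + C) {x : X} (hx : R x) (t : ℕ) :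
    expect (lawAt T x t) V + ∑ i ∈ Finset.range t, expect (lawAt T x i) f ≤ V x + t * C := by
  induction t with
  | zero => simp [lawAt, expect_pure]
  | succ t ih =>
    have h1 : expect (lawAt T x (t + 1)) V + expect (lawAt T x t) f
        ≤ expect (lawAt T x t) V + C := by
      rw [lawAt, expect_bind, ← expect_add, ← expect_const (lawAt T x t) C, ← expect_add]
      exact expect_mono _ fun y hy => by
        simpa [expect_const] using hdrift y (lawAt_support hR hx t y hy)
    rw [Finset.sum_range_succ]
    calc _ = (expect (lawAt T x (t + 1)) V + expect (lawAt T x t) f)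
          + ∑ i ∈ Finset.range t, expect (lawAt T x i) f := by ring
      _ ≤ (expect (lawAt T x t) V + C) + ∑ i ∈ Finset.range t, expect (lawAt T x i) f := by
          gcongr
      _ = (expect (lawAt T x t) V + ∑ i ∈ Finset.range t, expect (lawAt T x i) f) + C := by ring
      _ ≤ (V x + t * C) + C := by gcongr
      _ = _ := by push_cast; ring

theorem tendsto_expect_min_div [Countable X] (π : PMF X) (hV : ∀ x, V x ≠ ∞) {b : ℝ≥0∞}
    (hb : b ≠ ∞) :
    Tendsto (fun t : ℕ => expect π (fun x => min b (V x / t))) atTop (𝓝 0) := by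
  let _ : MeasurableSpace X := ⊤
  simp only [expect_eq_lintegral]
  have h := tendsto_lintegral_of_dominated_convergence (μ := π.toMeasure)
    (F := fun t : ℕ => fun x => min b (V x / t)) (f := fun _ => 0) (fun _ => b)
    (fun _ => measurable_from_top) (fun _ => ae_of_all _ fun _ => min_le_left _ _)
    (by simpa using hb) (ae_of_all _ fun x => ?_)
  · simpa using h
  · have h1 : Tendsto (fun t : ℕ => V x / t) atTop (𝓝 0) := by
      simpa using ENNReal.Tendsto.const_div ENNReal.tendsto_nat_nhds_top (Or.inr (hV x))
    simpa using (tendsto_const_nhds (x := b)).min h1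

/-- A drift inequality bounds the stationary mean of `f`, whether or not `V` has a finite
stationary mean. -/
theorem expect_stationary_le [Countable X] (hR : ∀ x, R x → ∀ y ∈ (T x).support, R y)
    (hV : ∀ x, V x ≠ ∞) (hf : ∀ x, f x ≠ ∞)
    (hdrift : ∀ x, R x → expect (T x) V + f x ≤ V x + C)
    {π : PMF X} (hπ : π.bind T = π) (hπR : ∀ x ∈ π.support, R x) :
    expect π f ≤ C := by
  classical
  rw [expect, ENNReal.tsum_eq_iSup_sum]
  refine iSup_le fun F => ?_
  -- Truncating `f` to the finite set `F` makes it bounded by `b`, so that its stationary mean is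
  -- finite and dominated convergence applies.
  set b : ℝ≥0∞ := ∑ x ∈ F, f x with hbdef
  have hb : b ≠ ∞ := by simp [hbdef, ENNReal.sum_eq_top, hf]
  set h : X → ℝ≥0∞ := fun x => if x ∈ F then f x else 0 with hh
  have hhf : ∀ x, h x ≤ f x := fun x => by simp only [hh]; split_ifs <;> simp
  have hhb : ∀ x, h x ≤ b := fun x => by
    simp only [hh]; split_ifs with hx
    · exact Finset.single_le_sum (f := f) (fun _ _ => zero_le) hx
    · exact zero_le
  have hFh : ∑ x ∈ F, π x * f x ≤ expect π h := by
    refine le_trans (le_of_eq ?_) (ENNReal.sum_le_tsum F)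
    exact Finset.sum_congr rfl fun x hx => by simp [hh, hx]
  refine hFh.trans ?_
  have key : ∀ t : ℕ, t ≠ 0 →
      expect π h ≤ C + expect π (fun x => min b (V x / t)) := by
    intro t ht
    have ht0 : (t : ℝ≥0∞) ≠ 0 := by exact_mod_cast ht
    have htt : (t : ℝ≥0∞) ≠ ∞ := ENNReal.natCast_ne_top t
    have h1 : (t : ℝ≥0∞) * expect π h
        = expect π (fun x => ∑ i ∈ Finset.range t, expect (lawAt T x i) h) := by
      rw [expect_finset_sum]
      have : ∀ i ∈ Finset.range t, expect π (fun x => expect (lawAt T x i) h) = expect π h := by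
        intro i _
        rw [← expect_bind, bind_lawAt hπ]
      rw [Finset.sum_congr rfl this]
      simp
    -- For each starting point the time average of `h` has two bounds: the trivial `b`, and `V x / t
    -- + C` from telescoping. Their minimum has a stationary mean tending to `C`, even if `V` itself
    -- is not integrable.
    have h2 : ∀ x ∈ π.support, ∑ i ∈ Finset.range t, expect (lawAt T x i) h
        ≤ t * (C + min b (V x / t)) := by
      intro x hx
      have e1 : ∑ i ∈ Finset.range t, expect (lawAt T x i) h ≤ t * b := by
        refine (Finset.sum_le_card_nsmul _ _ b fun i _ => ?_).trans (by simp)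
        exact (expect_mono _ fun y _ => hhb y).trans (expect_const _ b).le
      have e2 : ∑ i ∈ Finset.range t, expect (lawAt T x i) h ≤ V x + t * C :=
        (Finset.sum_le_sum fun i _ => expect_mono _ fun y _ => hhf y).trans
          (le_add_self.trans (expect_lawAt_add_sum_le hR hdrift (hπR x hx) t))
      rcases le_total b (V x / t) with hc | hc
      · rw [min_eq_left hc]
        exact e1.trans (by gcongr; exact le_add_self)
      · rw [min_eq_right hc, mul_add, ENNReal.mul_div_cancel ht0 htt, add_comm]
        exact e2
    have h3 : (t : ℝ≥0∞) * expect π h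
        ≤ t * (C + expect π (fun x => min b (V x / t))) := by
      rw [h1]
      refine (expect_mono π h2).trans ?_
      rw [expect_const_mul, expect_add, expect_const]
    exact (ENNReal.mul_le_mul_iff_right ht0 htt).1 h3
  have hlim : Tendsto (fun t : ℕ => C + expect π (fun x => min b (V x / t))) atTop (𝓝 (C + 0)) :=
    tendsto_const_nhds.add (tendsto_expect_min_div π hV hb)
  rw [add_zero] at hlim
  exact ge_of_tendsto hlim ((eventually_ne_atTop 0).mono key)

/-- Occupation frequencies of the first `t + 1` steps. -/
noncomputable def occupation (T : X → PMF X) (x : X) (t : ℕ) (y : X) : ℝ≥0∞ :=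
  (∑ i ∈ Finset.range (t + 1), lawAt T x i y) / (t + 1 : ℕ)

theorem tsum_occupation_mul (T : X → PMF X) (x : X) (t : ℕ) (g : X → ℝ≥0∞) :
    ∑' y, occupation T x t y * g y
      = (∑ i ∈ Finset.range (t + 1), expect (lawAt T x i) g) / (t + 1 : ℕ) := by
  have : ∀ y, occupation T x t y * g y
      = (∑ i ∈ Finset.range (t + 1), lawAt T x i y * g y) * ((t + 1 : ℕ) : ℝ≥0∞)⁻¹ := by
    intro y
    rw [occupation, div_eq_mul_inv, Finset.sum_mul, Finset.sum_mul, Finset.sum_mul]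
    exact Finset.sum_congr rfl fun i _ => by ring
  simp only [this, ENNReal.tsum_mul_right, div_eq_mul_inv]
  congr 1
  rw [Summable.tsum_finsetSum fun _ _ => ENNReal.summable]
  rfl

theorem tsum_occupation (T : X → PMF X) (x : X) (t : ℕ) : ∑' y, occupation T x t y = 1 := by
  have h := tsum_occupation_mul T x t (fun _ => 1)
  simp only [expect_const, mul_one] at h
  rw [h]
  simp only [Finset.sum_const, Finset.card_range, nsmul_eq_mul, mul_one]
  exact ENNReal.div_self (by simp) (ENNReal.natCast_ne_top _)

/-- Applying the kernel shifts the time window by one step, which adds at most one term of size at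
most one: occupation frequencies are almost invariant. -/
theorem tsum_occupation_mul_kernel_le (T : X → PMF X) (x : X) (t : ℕ) (y : X) :
    ∑' z, occupation T x t z * T z y ≤ occupation T x t y + ((t + 1 : ℕ) : ℝ≥0∞)⁻¹ := by
  rw [tsum_occupation_mul T x t fun z => T z y, occupation, div_eq_mul_inv, div_eq_mul_inv]
  have h : ∀ i, expect (lawAt T x i) (fun z => T z y) = lawAt T x (i + 1) y := fun i => rfl
  simp only [h]
  have h1 : ∑ i ∈ Finset.range (t + 1), lawAt T x (i + 1) y
      ≤ ∑ i ∈ Finset.range (t + 1), lawAt T x i y + 1 := by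
    have e : ∑ i ∈ Finset.range (t + 1), lawAt T x (i + 1) y
        ≤ ∑ i ∈ Finset.range (t + 1 + 1), lawAt T x i y := by
      rw [Finset.sum_range_succ' _ (t + 1)]
      exact le_self_add
    refine e.trans ?_
    rw [Finset.sum_range_succ _ (t + 1)]
    gcongr
    exact PMF.coe_le_one _ _
  calc _ ≤ (∑ i ∈ Finset.range (t + 1), lawAt T x i y + 1) * ((t + 1 : ℕ) : ℝ≥0∞)⁻¹ := by
        gcongr
    _ = _ := by rw [add_mul, one_mul]

theorem tsum_occupation_mul_le (hR : ∀ x, R x → ∀ y ∈ (T x).support, R y)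
    (hdrift : ∀ x, R x → expect (T x) V + f x ≤ V x + C) {x : X} (hx : R x) (t : ℕ) :
    ∑' y, occupation T x t y * f y ≤ V x + C := by
  rw [tsum_occupation_mul]
  refine ENNReal.div_le_of_le_mul ?_
  refine le_add_self.trans ((expect_lawAt_add_sum_le hR hdrift hx (t + 1)).trans ?_)
  rw [add_mul, mul_comm C]
  gcongr
  exact le_mul_of_one_le_right zero_le (by simp)

/-- A drift inequality with a function `f` of finite sublevel sets yields a stationary law. -/
theorem exists_stationary (hR : ∀ x, R x → ∀ y ∈ (T x).support, R y)
    (hV : ∀ x, V x ≠ ∞) (hC : C ≠ ∞)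
    (hdrift : ∀ x, R x → expect (T x) V + f x ≤ V x + C)
    (hfin : ∀ k : ℕ, {x | f x ≤ k}.Finite) {x : X} (hx : R x) :
    ∃ π : PMF X, (∀ y ∈ π.support, R y) ∧ π.bind T = π := by
  classical
  -- Compactness of `[0, ∞]` gives limits at all states simultaneously along one ultrafilter,
  -- without extracting subsequences.
  have hex : ∀ y, ∃ l, Tendsto (fun t => occupation T x t y) (hyperfilter ℕ) (𝓝 l) := by
    intro y
    obtain ⟨l, -, hl⟩ := isCompact_univ.ultrafilter_le_nhds
      ((hyperfilter ℕ).map fun t => occupation T x t y) (by simp)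
    exact ⟨l, hl⟩
  choose g hg using hex
  have hsum : ∀ F : Finset X, Tendsto (fun t => ∑ y ∈ F, occupation T x t y) (hyperfilter ℕ)
      (𝓝 (∑ y ∈ F, g y)) := fun F => tendsto_finsetSum F fun y _ => hg y
  have hle : ∑' y, g y ≤ 1 := by
    rw [ENNReal.tsum_eq_iSup_sum]
    refine iSup_le fun F => le_of_tendsto (hsum F) (Eventually.of_forall fun t => ?_)
    exact (ENNReal.sum_le_tsum F).trans (tsum_occupation T x t).le
  have hB : V x + C ≠ ∞ := by simp [hV, hC]
  -- No mass escapes to infinity: by Markov's inequality the frequencies put at most `(V x + C) / k`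
  -- outside the finite set `{f ≤ k}`, uniformly in time.
  have hge : 1 ≤ ∑' y, g y := by
    have key : ∀ k : ℕ, k ≠ 0 → 1 ≤ ∑' y, g y + (V x + C) / k := by
      intro k hk
      have hk0 : (k : ℝ≥0∞) ≠ 0 := by exact_mod_cast hk
      have e : ∀ t, 1 ≤ ∑ y ∈ (hfin k).toFinset, occupation T x t y + (V x + C) / k := by
        intro t
        rw [← tsum_occupation T x t]
        have e1 : ∀ y, occupation T x t y ≤
            (if y ∈ (hfin k).toFinset then occupation T x t y else 0)
              + occupation T x t y * f y * (k : ℝ≥0∞)⁻¹ := by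
          intro y
          split_ifs with hy
          · exact le_self_add
          · rw [zero_add, mul_assoc]
            refine le_mul_of_one_le_right zero_le ?_
            have : (k : ℝ≥0∞) < f y := by simpa using hy
            rw [← div_eq_mul_inv]
            exact (ENNReal.le_div_iff_mul_le (Or.inl hk0)
              (Or.inl (ENNReal.natCast_ne_top k))).2 (by simpa using this.le)
        refine (ENNReal.tsum_le_tsum e1).trans ?_
        rw [ENNReal.tsum_add, ENNReal.tsum_mul_right, div_eq_mul_inv]
        gcongr
        · rw [tsum_eq_sum (s := (hfin k).toFinset)]
          · exact Finset.sum_le_sum fun y hy => by simp only [hy, if_true, le_refl]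
          · intro y hy
            simp only [hy, if_false]
        · exact tsum_occupation_mul_le hR hdrift hx t
      refine (ge_of_tendsto ((hsum _).add_const _) (Eventually.of_forall e)).trans ?_
      gcongr
      exact ENNReal.sum_le_tsum _
    have hlim : Tendsto (fun k : ℕ => ∑' y, g y + (V x + C) / k) atTop (𝓝 (∑' y, g y + 0)) := by
      refine tendsto_const_nhds.add ?_
      simpa using ENNReal.Tendsto.const_div ENNReal.tendsto_nat_nhds_top (Or.inr hB)
    rw [add_zero] at hlim
    exact ge_of_tendsto hlim ((eventually_ne_atTop 0).mono key)
  have hone : ∑' y, g y = 1 := le_antisymm hle hge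
  obtain ⟨π, hπ⟩ : ∃ π : PMF X, ∀ y, π y = g y :=
    ⟨⟨g, hone ▸ ENNReal.summable.hasSum⟩, fun _ => rfl⟩
  refine ⟨π, ?_, ?_⟩
  · intro y hy
    by_contra hRy
    have h0 : ∀ t, occupation T x t y = 0 := by
      intro t
      have : ∀ i ∈ Finset.range (t + 1), lawAt T x i y = 0 := by
        intro i _
        by_contra hne
        exact hRy (lawAt_support hR hx i y ((PMF.mem_support_iff _ _).2 hne))
      simp [occupation, Finset.sum_eq_zero this]
    have h1 := hg y
    simp only [h0] at h1
    have h2 : g y = 0 := tendsto_nhds_unique h1 tendsto_const_nhds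
    exact (PMF.mem_support_iff _ _).1 hy ((hπ y).trans h2)
  -- Only finite partial sums pass to the limit, which yields `π T ≤ π`; equality follows since both
  -- have mass one.
  · refine pmf_eq_of_le fun y => ?_
    rw [PMF.bind_apply, ENNReal.tsum_eq_iSup_sum]
    refine iSup_le fun F => ?_
    simp only [hπ]
    have h1 : Tendsto (fun t => ∑ z ∈ F, occupation T x t z * T z y) (hyperfilter ℕ)
        (𝓝 (∑ z ∈ F, g z * T z y)) := by
      refine tendsto_finsetSum F fun z _ => ?_
      exact ENNReal.Tendsto.mul_const (hg z) (Or.inr ((T z).apply_ne_top y))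
    have h2 : Tendsto (fun t : ℕ => occupation T x t y + ((t + 1 : ℕ) : ℝ≥0∞)⁻¹)
        (hyperfilter ℕ) (𝓝 (g y + 0)) := by
      refine (hg y).add ?_
      refine Tendsto.mono_left ?_ Nat.hyperfilter_le_atTop
      exact ENNReal.tendsto_inv_nat_nhds_zero.comp (tendsto_add_atTop_nat 1)
    rw [add_zero] at h2
    exact le_of_tendsto_of_tendsto' h1 h2 fun t =>
      (ENNReal.sum_le_tsum F).trans (tsum_occupation_mul_kernel_le T x t y)

end MarkovChain

/-! ### From extended nonnegative expectations to real integrals, where signed terms are allowed. -/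

section Bridge

variable {α : Type*} [Countable α] [MeasurableSpace α] [MeasurableSingletonClass α]

theorem integrable_of_expect {P : PMF α} {g : α → ℝ} (hg : ∀ x, 0 ≤ g x)
    (h : expect P (fun x => ENNReal.ofReal (g x)) ≠ ∞) : Integrable g P.toMeasure := by
  refine ⟨(measurable_of_countable g).aestronglyMeasurable, ?_⟩
  rw [hasFiniteIntegral_iff_ofReal (ae_of_all _ hg), ← expect_eq_lintegral]
  exact h.lt_top

theorem integral_eq_toReal_expect {P : PMF α} {g : α → ℝ} (hg : ∀ x, 0 ≤ g x) :
    ∫ x, g x ∂P.toMeasure = (expect P (fun x => ENNReal.ofReal (g x))).toReal := by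
  rw [integral_eq_lintegral_of_nonneg_ae (ae_of_all _ hg)
    (measurable_of_countable g).aestronglyMeasurable, ← expect_eq_lintegral]

theorem ae_of_support {P : PMF α} {p : α → Prop} (h : ∀ x ∈ P.support, p x) :
    ∀ᵐ x ∂P.toMeasure, p x := by
  rw [ae_iff, P.toMeasure_apply_eq_zero_iff (Set.to_countable _).measurableSet]
  rw [Set.disjoint_left]
  exact fun x hx hpx => hpx (h x hx)

/-- The majorant `G` may contain signed terms whose means cancel. Comparison on the support
suffices, which matters because the bound on estimate increments holds only there. -/
theorem expect_ofReal_le_integral {P : PMF α} {F G : α → ℝ} (hF : ∀ x, 0 ≤ F x)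
    (hFG : ∀ x ∈ P.support, F x ≤ G x) (hG : Integrable G P.toMeasure) :
    expect P (fun x => ENNReal.ofReal (F x)) ≤ ENNReal.ofReal (∫ x, G x ∂P.toMeasure) := by
  have hG0 : 0 ≤ᵐ[P.toMeasure] G := ae_of_support fun x hx => (hF x).trans (hFG x hx)
  rw [ofReal_integral_eq_lintegral_ofReal hG hG0, ← expect_eq_lintegral]
  exact expect_mono P fun x hx => ENNReal.ofReal_le_ofReal (hFG x hx)

end Bridge

/-! ### Countability of states and slots, so that every function is measurable. -/

section Countability

variable {M N : ℕ}

instance : Countable (State M N) := by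
  have h : Function.Injective fun z : State M N => (z.queue, z.est) := by
    rintro ⟨a, b⟩ ⟨c, d⟩ h
    simpa using h
  exact h.countable

instance : Countable (UpdateDecision M N) := by
  have h : Function.Injective fun u : UpdateDecision M N => (u.sync, u.incr) := by
    rintro ⟨a, b⟩ ⟨c, d⟩ h
    simpa using h
  exact h.countable

instance : Countable (Slot M N) := by
  have h : Function.Injective fun w : Slot M N => (w.arr, w.choice, w.serv, w.upd) := by
    rintro ⟨a, b, c, d⟩ ⟨a', b', c', d'⟩ h
    simpa using h
  exact h.countable

instance : MeasurableSpace (Slot M N) := ⊤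

instance : MeasurableSingletonClass (Slot M N) := ⟨fun _ => trivial⟩

end Countability

/-! ### Moments of arrivals, services and load in one slot. -/

section SlotMoments

variable {M N : ℕ} (arrival : PMF (Fin M → ℕ)) (service : Fin N → PMF ℕ)
  (pol : Policy M N) (z : State M N)

theorem expect_slotLaw_arr (g : (Fin M → ℕ) → ℝ≥0∞) :
    expect (slotLaw arrival service pol z) (fun w => g w.arr) = expect arrival g := by
  simp [slotLaw, expect_bind, expect_map, expect_const]

theorem expect_slotLaw_serv (n : Fin N) (g : ℕ → ℝ≥0∞) :
    expect (slotLaw arrival service pol z) (fun w => g (w.serv n)) = expect (service n) g := by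
  simp [slotLaw, expect_bind, expect_map, expect_const, expect_indep_coord]

/-- Given the state, the choice of dispatcher `m` is independent of its arrivals, so the mean
factorizes. -/
theorem expect_slotLaw_sent (m : Fin M) (n : Fin N) :
    expect (slotLaw arrival service pol z) (fun w => (sent w.arr w.choice m n : ℝ≥0∞))
      = pol.dispatch m (z.est m) n * expect arrival (fun a => (a m : ℝ≥0∞)) := by
  simp only [slotLaw, expect_bind, expect_map, expect_const]
  rw [← expect_const_mul]
  congr 1
  ext a
  have h := expect_indep_coord (fun m => pol.dispatch m (z.est m)) m
    (fun k => (a m : ℝ≥0∞) * if k = n then 1 else 0)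
  rw [expect_const_mul (pol.dispatch m (z.est m))] at h
  have h2 : expect (pol.dispatch m (z.est m)) (fun k => if k = n then 1 else 0)
      = pol.dispatch m (z.est m) n := by
    rw [expect, tsum_eq_single n]
    · simp
    · intro k hk
      simp [hk]
  rw [h2, mul_comm] at h
  rw [← h]
  congr 1
  ext d
  by_cases hd : d m = n <;> simp [sent, hd]

/-- Mean number of arrivals at dispatcher `m` in a slot. -/
noncomputable def arrivalRate (m : Fin M) : ℝ := (expect arrival fun a => (a m : ℝ≥0∞)).toReal

/-- All tasks that arrive plus all service offered in a slot. -/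
def slotLoad (w : Slot M N) : ℝ := ((∑ m, w.arr m : ℕ) : ℝ) + ∑ n, (w.serv n : ℝ)

/-- Bound of the `k`-th moment of the load of a slot. -/
noncomputable def loadMoment (N : ℕ) (θ₁ θ₂ D₁ D₂ : ℝ) (k : ℕ) : ℝ :=
  (ENNReal.ofReal ((N + 1) ^ k * k.factorial * ((θ₁ ^ k)⁻¹ + (θ₂ ^ k)⁻¹))
    * (ENNReal.ofReal D₁ + N * ENNReal.ofReal D₂)).toReal

theorem loadMoment_nonneg (N : ℕ) (θ₁ θ₂ D₁ D₂ : ℝ) (k : ℕ) :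
    0 ≤ loadMoment N θ₁ θ₂ D₁ D₂ k := ENNReal.toReal_nonneg

theorem slotLoad_nonneg (w : Slot M N) : 0 ≤ slotLoad w := by
  unfold slotLoad
  positivity

theorem pow_le_factorial_mul_exp {θ x : ℝ} (hθ : 0 < θ) (hx : 0 ≤ x) (k : ℕ) :
    x ^ k ≤ k.factorial * (θ ^ k)⁻¹ * Real.exp (θ * x) := by
  have h := Real.pow_div_factorial_le_exp (x := θ * x) (by positivity) k
  rw [div_le_iff₀ (by positivity), mul_pow] at h
  have : x ^ k = (θ ^ k)⁻¹ * (θ ^ k * x ^ k) := by field_simp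
  rw [this]
  calc _ ≤ (θ ^ k)⁻¹ * (Real.exp (θ * x) * k.factorial) := by gcongr
    _ = _ := by ring

/-- Every summand is at most the largest one `x`, and `x ^ k` is itself among the terms on the
right. -/
theorem add_sum_pow_le {ι : Type*} [Fintype ι] {u : ℝ} {s : ι → ℝ} (hu : 0 ≤ u)
    (hs : ∀ i, 0 ≤ s i) (k : ℕ) :
    (u + ∑ i, s i) ^ k ≤ (Fintype.card ι + 1) ^ k * (u ^ k + ∑ i, s i ^ k) := by
  have hx : ∃ x, 0 ≤ x ∧ u ≤ x ∧ (∀ i, s i ≤ x) ∧ x ^ k ≤ u ^ k + ∑ i, s i ^ k := by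
    have hsk : 0 ≤ ∑ i, s i ^ k := Finset.sum_nonneg fun i _ => pow_nonneg (hs i) k
    by_cases h : ∀ i, s i ≤ u
    · exact ⟨u, hu, le_rfl, h, by linarith⟩
    · push Not at h
      obtain ⟨i₀, hi₀⟩ := h
      obtain ⟨i, -, hi⟩ := Finset.exists_max_image Finset.univ s ⟨i₀, Finset.mem_univ _⟩
      refine ⟨s i, hs i, hi₀.le.trans (hi i₀ (Finset.mem_univ _)),
        fun j => hi j (Finset.mem_univ _), ?_⟩
      have := Finset.single_le_sum (f := fun i => s i ^ k)
        (fun i _ => pow_nonneg (hs i) k) (Finset.mem_univ i)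
      have := pow_nonneg hu k
      linarith
  obtain ⟨x, hx0, hux, hsx, hxk⟩ := hx
  have h1 : u + ∑ i, s i ≤ (Fintype.card ι + 1) * x := by
    have : ∑ i, s i ≤ ∑ _i : ι, x := Finset.sum_le_sum fun i _ => hsx i
    simp only [Finset.sum_const, Finset.card_univ, nsmul_eq_mul] at this
    linarith
  have h0 : 0 ≤ u + ∑ i, s i := add_nonneg hu (Finset.sum_nonneg fun i _ => hs i)
  calc _ ≤ ((Fintype.card ι + 1) * x) ^ k := by gcongr
    _ = (Fintype.card ι + 1) ^ k * x ^ k := mul_pow _ _ _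
    _ ≤ _ := by gcongr

variable {θ₁ θ₂ D₁ D₂ ε : ℝ}

theorem slotLoad_pow_le (hθ₁ : 0 < θ₁) (hθ₂ : 0 < θ₂) (w : Slot M N) (k : ℕ) :
    slotLoad w ^ k ≤ ((N + 1) ^ k * k.factorial * ((θ₁ ^ k)⁻¹ + (θ₂ ^ k)⁻¹)) *
      (Real.exp (θ₁ * ((∑ m, w.arr m : ℕ) : ℝ)) + ∑ n, Real.exp (θ₂ * (w.serv n : ℝ))) := by
  have h := add_sum_pow_le (u := ((∑ m, w.arr m : ℕ) : ℝ)) (s := fun n => (w.serv n : ℝ))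
    (by positivity) (fun n => by positivity) k
  have h1 := pow_le_factorial_mul_exp hθ₁ (x := ((∑ m, w.arr m : ℕ) : ℝ)) (by positivity) k
  have h2 : ∑ n, (w.serv n : ℝ) ^ k
      ≤ k.factorial * (θ₂ ^ k)⁻¹ * ∑ n, Real.exp (θ₂ * (w.serv n : ℝ)) := by
    rw [Finset.mul_sum]
    exact Finset.sum_le_sum fun n _ => pow_le_factorial_mul_exp hθ₂ (by positivity) k
  rw [Fintype.card_fin] at h
  refine h.trans ?_
  rw [mul_assoc, mul_assoc]
  gcongr
  set E₁ := Real.exp (θ₁ * ((∑ m, w.arr m : ℕ) : ℝ))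
  set E₂ := ∑ n, Real.exp (θ₂ * (w.serv n : ℝ))
  have e1 : 0 ≤ E₁ := (Real.exp_pos _).le
  have e2 : 0 ≤ E₂ := Finset.sum_nonneg fun n _ => (Real.exp_pos _).le
  have e3 : 0 ≤ (k.factorial : ℝ) * (θ₂ ^ k)⁻¹ * E₁ := by positivity
  have e4 : 0 ≤ (k.factorial : ℝ) * (θ₁ ^ k)⁻¹ * E₂ := by positivity
  nlinarith

/-- The bound involves only `N` and the tail constants; this is what makes the drift constants
uniform in `ε` and in the policy. -/
theorem expect_slotLoad_pow_le (hθ₁ : 0 < θ₁) (hθ₂ : 0 < θ₂)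
    (harr : IsArrivalLaw service θ₁ D₁ ε arrival)
    (htail : ∀ n, expect (service n) (fun s => ENNReal.ofReal (Real.exp (θ₂ * (s : ℝ))))
      ≤ ENNReal.ofReal D₂) (k : ℕ) :
    expect (slotLaw arrival service pol z) (fun w => ENNReal.ofReal (slotLoad w ^ k))
      ≤ ENNReal.ofReal (loadMoment N θ₁ θ₂ D₁ D₂ k) := by
  rw [loadMoment, ENNReal.ofReal_toReal (by finiteness)]
  refine (expect_mono _ fun w _ =>
    ENNReal.ofReal_le_ofReal (slotLoad_pow_le hθ₁ hθ₂ w k)).trans ?_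
  have hc : (0 : ℝ) ≤ (N + 1) ^ k * k.factorial * ((θ₁ ^ k)⁻¹ + (θ₂ ^ k)⁻¹) := by positivity
  have hsplit : ∀ w : Slot M N, ENNReal.ofReal
      (((N + 1) ^ k * k.factorial * ((θ₁ ^ k)⁻¹ + (θ₂ ^ k)⁻¹)) *
      (Real.exp (θ₁ * ((∑ m, w.arr m : ℕ) : ℝ)) + ∑ n, Real.exp (θ₂ * (w.serv n : ℝ))))
      = ENNReal.ofReal ((N + 1) ^ k * k.factorial * ((θ₁ ^ k)⁻¹ + (θ₂ ^ k)⁻¹)) *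
        (ENNReal.ofReal (Real.exp (θ₁ * ((∑ m, w.arr m : ℕ) : ℝ)))
          + ∑ n, ENNReal.ofReal (Real.exp (θ₂ * (w.serv n : ℝ)))) := by
    intro w
    rw [ENNReal.ofReal_mul hc, ENNReal.ofReal_add (Real.exp_pos _).le
      (Finset.sum_nonneg fun n _ => (Real.exp_pos _).le),
      ENNReal.ofReal_sum_of_nonneg fun n _ => (Real.exp_pos _).le]
  simp only [hsplit]
  rw [expect_const_mul, expect_add, expect_finset_sum]
  gcongr
  · rw [expect_slotLaw_arr arrival service pol z
      (fun a => ENNReal.ofReal (Real.exp (θ₁ * ((∑ m, a m : ℕ) : ℝ))))]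
    exact harr.light_tail
  · refine (Finset.sum_le_card_nsmul _ _ (ENNReal.ofReal D₂) fun n _ => ?_).trans (by simp)
    rw [expect_slotLaw_serv arrival service pol z n
      (fun s => ENNReal.ofReal (Real.exp (θ₂ * (s : ℝ))))]
    exact htail n

theorem integrable_slotLoad_pow (hθ₁ : 0 < θ₁) (hθ₂ : 0 < θ₂)
    (harr : IsArrivalLaw service θ₁ D₁ ε arrival)
    (htail : ∀ n, expect (service n) (fun s => ENNReal.ofReal (Real.exp (θ₂ * (s : ℝ))))
      ≤ ENNReal.ofReal D₂) (k : ℕ) :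
    Integrable (fun w => slotLoad w ^ k) (slotLaw arrival service pol z).toMeasure :=
  integrable_of_expect (fun w => pow_nonneg (slotLoad_nonneg w) k)
    ((expect_slotLoad_pow_le arrival service pol z hθ₁ hθ₂ harr htail k).trans_lt
      ENNReal.ofReal_lt_top).ne

theorem integral_slotLoad_pow_le (hθ₁ : 0 < θ₁) (hθ₂ : 0 < θ₂)
    (harr : IsArrivalLaw service θ₁ D₁ ε arrival)
    (htail : ∀ n, expect (service n) (fun s => ENNReal.ofReal (Real.exp (θ₂ * (s : ℝ))))
      ≤ ENNReal.ofReal D₂) (k : ℕ) :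
    ∫ w, slotLoad w ^ k ∂(slotLaw arrival service pol z).toMeasure
      ≤ loadMoment N θ₁ θ₂ D₁ D₂ k := by
  rw [integral_eq_toReal_expect fun w => pow_nonneg (slotLoad_nonneg w) k]
  exact ENNReal.toReal_le_of_le_ofReal (loadMoment_nonneg _ _ _ _ _ _)
    (expect_slotLoad_pow_le arrival service pol z hθ₁ hθ₂ harr htail k)

theorem sent_le_slotLoad (w : Slot M N) (m : Fin M) (n : Fin N) :
    (sent w.arr w.choice m n : ℝ) ≤ slotLoad w := by
  have h1 : sent w.arr w.choice m n ≤ ∑ m, w.arr m := by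
    refine le_trans ?_ (Finset.single_le_sum (f := w.arr) (fun _ _ => Nat.zero_le _)
      (Finset.mem_univ m))
    unfold sent
    split_ifs <;> simp
  have h2 : (0 : ℝ) ≤ ∑ n, (w.serv n : ℝ) := by positivity
  have h3 : (sent w.arr w.choice m n : ℝ) ≤ ((∑ m, w.arr m : ℕ) : ℝ) := by exact_mod_cast h1
  unfold slotLoad
  linarith

theorem serv_le_slotLoad (w : Slot M N) (n : Fin N) : (w.serv n : ℝ) ≤ slotLoad w := by
  have h1 := Finset.single_le_sum (f := fun n => (w.serv n : ℝ)) (fun _ _ => by positivity)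
      (Finset.mem_univ n)
  have h2 : (0 : ℝ) ≤ ((∑ m, w.arr m : ℕ) : ℝ) := by positivity
  unfold slotLoad
  linarith

theorem integrable_of_le_slotLoad (hθ₁ : 0 < θ₁) (hθ₂ : 0 < θ₂)
    (harr : IsArrivalLaw service θ₁ D₁ ε arrival)
    (htail : ∀ n, expect (service n) (fun s => ENNReal.ofReal (Real.exp (θ₂ * (s : ℝ))))
      ≤ ENNReal.ofReal D₂) {g : Slot M N → ℝ} (hg0 : ∀ w, 0 ≤ g w)
    (hg : ∀ w, g w ≤ slotLoad w) :
    Integrable g (slotLaw arrival service pol z).toMeasure := by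
  refine Integrable.mono'
    (integrable_slotLoad_pow arrival service pol z hθ₁ hθ₂ harr htail 1)
    (measurable_of_countable g).aestronglyMeasurable (ae_of_all _ fun w => ?_)
  rw [Real.norm_of_nonneg (hg0 w), pow_one]
  exact hg w

theorem integral_serv (n : Fin N) :
    ∫ w, (w.serv n : ℝ) ∂(slotLaw arrival service pol z).toMeasure = serviceRate service n := by
  rw [integral_eq_toReal_expect fun w => by positivity, serviceRate,
    ← expect_slotLaw_serv arrival service pol z n]
  simp

theorem integral_sent (m : Fin M) (n : Fin N) :
    ∫ w, (sent w.arr w.choice m n : ℝ) ∂(slotLaw arrival service pol z).toMeasure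
      = arrivalRate arrival m * (pol.dispatch m (z.est m) n).toReal := by
  rw [integral_eq_toReal_expect fun w => by positivity]
  simp only [ENNReal.ofReal_natCast]
  rw [expect_slotLaw_sent, ENNReal.toReal_mul, mul_comm, arrivalRate]

theorem integral_sync_ge {p : ℝ} (hreach : Reachable arrival service pol z)
    (hupd : UpdatesWithProb arrival service pol p) (m : Fin M) (n : Fin N) :
    p ≤ ∫ w, (if w.upd.sync m n then 1 else 0 : ℝ) ∂(slotLaw arrival service pol z).toMeasure := by
  rw [integral_eq_toReal_expect fun w => by split_ifs <;> simp]
  have h := hupd z hreach m n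
  have e : ∀ w : Slot M N, ENNReal.ofReal (if w.upd.sync m n then 1 else 0 : ℝ)
      = if w.upd.sync m n then 1 else 0 := fun w => by split_ifs <;> simp
  simp only [e]
  refine (ENNReal.ofReal_le_iff_le_toReal ?_).1 h
  refine ne_top_of_le_ne_top ENNReal.one_ne_top
    ((expect_mono _ fun w _ => ?_).trans (expect_const _ 1).le)
  split_ifs <;> simp

theorem integrable_sync (m : Fin M) (n : Fin N) :
    Integrable (fun w => (if w.upd.sync m n then 1 else 0 : ℝ))
      (slotLaw arrival service pol z).toMeasure := by
  refine Integrable.mono' (integrable_const (1 : ℝ))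
    (measurable_of_countable _).aestronglyMeasurable (ae_of_all _ fun w => ?_)
  split_ifs <;> simp

theorem arrivalRate_nonneg (m : Fin M) : 0 ≤ arrivalRate arrival m := ENNReal.toReal_nonneg

variable {arrival service}

theorem sum_arrivalRate (hθ₁ : 0 < θ₁) (harr : IsArrivalLaw service θ₁ D₁ ε arrival) :
    ∑ m, arrivalRate arrival m = totalArrivalRate arrival := by
  -- The light tail gives a finite mean, without which `toReal` would not commute with the sum.
  have hfin : expect arrival (fun a => ((∑ m, a m : ℕ) : ℝ≥0∞)) ≠ ∞ := by
    have h : expect arrival (fun a => ((∑ m, a m : ℕ) : ℝ≥0∞)) ≤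
        expect arrival (fun a => ENNReal.ofReal θ₁⁻¹ *
          ENNReal.ofReal (Real.exp (θ₁ * ((∑ m, a m : ℕ) : ℝ)))) := by
      refine expect_mono _ fun a _ => ?_
      rw [← ENNReal.ofReal_mul (by positivity), ← ENNReal.ofReal_natCast]
      refine ENNReal.ofReal_le_ofReal ?_
      have := pow_le_factorial_mul_exp hθ₁ (x := ((∑ m, a m : ℕ) : ℝ)) (by positivity) 1
      simpa using this
    rw [expect_const_mul] at h
    refine ne_top_of_le_ne_top ?_ (h.trans (mul_le_mul_right harr.light_tail _))
    finiteness
  have hsum : expect arrival (fun a => ((∑ m, a m : ℕ) : ℝ≥0∞))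
      = ∑ m, expect arrival (fun a => (a m : ℝ≥0∞)) := by
    rw [← expect_finset_sum]
    simp
  unfold totalArrivalRate arrivalRate
  rw [hsum, ENNReal.toReal_sum]
  intro m _
  rw [hsum] at hfin
  exact fun h => hfin (ENNReal.sum_eq_top.2 ⟨m, Finset.mem_univ m, h⟩)

end SlotMoments

/-! ### Elementary inequalities for powers. -/

section RealInequalities

/-- First-order Taylor bound by induction: the remainder obeys `R (t+1) = b * R t + (t+1) * a^t *
(b-a)^2`. The form of `hJ` fits `a = x²`, `b = y²`, `B = (x+y)²`. -/
theorem pow_succ_taylor_le {a b B J : ℝ} (ha : 0 ≤ a) (hb : 0 ≤ b) (haB : a ≤ B) (hbB : b ≤ B)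
    (hJ : (b - a) ^ 2 ≤ J ^ 2 * B) (t : ℕ) :
    b ^ (t + 1) - a ^ (t + 1) - (t + 1) * a ^ t * (b - a) ≤ (t + 1) ^ 2 * J ^ 2 * B ^ t := by
  have hB : 0 ≤ B := ha.trans haB
  induction t with
  | zero =>
    have := sq_nonneg J
    simp
    linarith
  | succ t ih =>
    have e : b ^ (t + 1 + 1) - a ^ (t + 1 + 1) - ((t + 1 : ℕ) + 1) * a ^ (t + 1) * (b - a)
        = b * (b ^ (t + 1) - a ^ (t + 1) - (t + 1) * a ^ t * (b - a))
          + (t + 1) * (a ^ t * (b - a) ^ 2) := by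
      push_cast
      ring
    rw [e]
    have h1 : b * (b ^ (t + 1) - a ^ (t + 1) - (t + 1) * a ^ t * (b - a))
        ≤ B * ((t + 1) ^ 2 * J ^ 2 * B ^ t) :=
      (mul_le_mul_of_nonneg_left ih hb).trans (by gcongr)
    have h2 : a ^ t * (b - a) ^ 2 ≤ B ^ t * (J ^ 2 * B) := by gcongr
    have h3 : (0 : ℝ) ≤ J ^ 2 * B ^ (t + 1) := by positivity
    calc _ ≤ B * ((t + 1) ^ 2 * J ^ 2 * B ^ t) + (t + 1) * (B ^ t * (J ^ 2 * B)) := by gcongr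
      _ = ((t + 1) ^ 2 + (t + 1)) * (J ^ 2 * B ^ (t + 1)) := by ring
      _ ≤ ((t + 1 : ℕ) + 1) ^ 2 * (J ^ 2 * B ^ (t + 1)) := by
        gcongr
        push_cast
        nlinarith
      _ = _ := by ring

/-- The expansion is in `y ^ 2 - x ^ 2` because the drift of the squared norm is the one that can be
computed. -/
theorem even_pow_le_of_abs_sub_le {x y J : ℝ} (hx : 0 ≤ x) (hy : 0 ≤ y) (hxy : |y - x| ≤ J)
    (t : ℕ) :
    y ^ (2 * t + 2) ≤ x ^ (2 * t + 2) + (t + 1) * x ^ (2 * t) * (y ^ 2 - x ^ 2)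
      + (t + 1) ^ 2 * 9 ^ t * (x ^ (2 * t) * J ^ 2 + J ^ (2 * t + 2)) := by
  have hJ0 : 0 ≤ J := (abs_nonneg _).trans hxy
  have hsq : (y - x) ^ 2 ≤ J ^ 2 := by
    rw [← sq_abs]
    gcongr
  have h := pow_succ_taylor_le (a := x ^ 2) (b := y ^ 2) (B := (x + y) ^ 2) (J := J)
    (by positivity) (by positivity) (by nlinarith) (by nlinarith)
    (by
      have : (y ^ 2 - x ^ 2) ^ 2 = (y - x) ^ 2 * (x + y) ^ 2 := by ring
      rw [this]
      gcongr) t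
  have hyx : y ≤ x + J := by linarith [(abs_le.1 hxy).2]
  -- The constant 9 is `3²`, from `x + y ≤ 2 * x + J ≤ 3 * max x J`.
  have hpow : ((x + y) ^ 2) ^ t ≤ 9 ^ t * (x ^ (2 * t) + J ^ (2 * t)) := by
    have h9 : ∀ u : ℝ, 9 ^ t * u ^ (2 * t) = ((3 * u) ^ 2) ^ t := by
      intro u
      rw [mul_pow, mul_pow, pow_mul]
      norm_num
    rw [mul_add, h9, h9]
    rcases le_total x J with hc | hc
    · have : ((x + y) ^ 2) ^ t ≤ ((3 * J) ^ 2) ^ t := by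
        gcongr
        linarith
      have : 0 ≤ ((3 * x) ^ 2) ^ t := by positivity
      linarith
    · have : ((x + y) ^ 2) ^ t ≤ ((3 * x) ^ 2) ^ t := by
        gcongr
        linarith
      have : 0 ≤ ((3 * J) ^ 2) ^ t := by positivity
      linarith
  have e1 : (x ^ 2) ^ (t + 1) = x ^ (2 * t + 2) := by rw [← pow_mul]; ring_nf
  have e2 : (y ^ 2) ^ (t + 1) = y ^ (2 * t + 2) := by rw [← pow_mul]; ring_nf
  have e3 : (x ^ 2) ^ t = x ^ (2 * t) := by rw [← pow_mul]
  rw [e1, e2, e3] at h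
  have h4 : (t + 1 : ℝ) ^ 2 * J ^ 2 * ((x + y) ^ 2) ^ t
      ≤ (t + 1) ^ 2 * J ^ 2 * (9 ^ t * (x ^ (2 * t) + J ^ (2 * t))) := by gcongr
  have e5 : (t + 1 : ℝ) ^ 2 * J ^ 2 * (9 ^ t * (x ^ (2 * t) + J ^ (2 * t)))
      = (t + 1) ^ 2 * 9 ^ t * (x ^ (2 * t) * J ^ 2 + J ^ (2 * t + 2)) := by ring
  linarith

/-- If `J ≤ η * e`, the factor `(1 + η) ^ r` is close to one; otherwise `J` dominates `e`. Having `1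
+ κ` near one preserves the contraction due to synchronization. -/
theorem exists_add_pow_le {κ : ℝ} (hκ : 0 < κ) (r : ℕ) :
    ∃ C : ℝ, 0 ≤ C ∧ ∀ e J : ℝ, 0 ≤ e → 0 ≤ J → (e + J) ^ r ≤ (1 + κ) * e ^ r + C * J ^ r := by
  obtain ⟨η, hη, hηκ⟩ : ∃ η : ℝ, 0 < η ∧ (1 + η) ^ r ≤ 1 + κ := by
    have hlim : Tendsto (fun η : ℝ => (1 + η) ^ r) (𝓝[>] 0) (𝓝 1) := by
      have : Continuous fun η : ℝ => (1 + η) ^ r := by fun_prop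
      simpa using (this.tendsto 0).mono_left nhdsWithin_le_nhds
    have h1 := hlim.eventually (eventually_le_nhds (show (1 : ℝ) < 1 + κ by linarith))
    obtain ⟨η, h2, h3⟩ := (h1.and self_mem_nhdsWithin).exists
    exact ⟨η, h3, h2⟩
  refine ⟨(η⁻¹ + 1) ^ r, by positivity, fun e J he hJ => ?_⟩
  rcases le_total J (η * e) with h | h
  · have h1 : (e + J) ^ r ≤ ((1 + η) * e) ^ r := by
      gcongr
      linarith
    rw [mul_pow] at h1
    have h2 : (1 + η) ^ r * e ^ r ≤ (1 + κ) * e ^ r := by gcongr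
    have h3 : 0 ≤ (η⁻¹ + 1) ^ r * J ^ r := by positivity
    linarith
  · have h0 : e ≤ η⁻¹ * J := by
      rw [inv_mul_eq_div, le_div_iff₀ hη]
      linarith
    have h1 : (e + J) ^ r ≤ ((η⁻¹ + 1) * J) ^ r := by
      gcongr
      linarith
    rw [mul_pow] at h1
    have h3 : 0 ≤ (1 + κ) * e ^ r := by positivity
    linarith

/-- A form of Young's inequality, by comparing `e` with `γ * x`. -/
theorem pow_mul_le {γ x e : ℝ} (hγ : 0 < γ) (hx : 0 ≤ x) (he : 0 ≤ e) (t : ℕ) :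
    x ^ t * e ≤ γ * x ^ (t + 1) + γ⁻¹ ^ t * e ^ (t + 1) := by
  rcases le_total e (γ * x) with h | h
  · have h1 : x ^ t * e ≤ x ^ t * (γ * x) := by gcongr
    have h2 : 0 ≤ γ⁻¹ ^ t * e ^ (t + 1) := by positivity
    have h3 : x ^ t * (γ * x) = γ * x ^ (t + 1) := by ring
    linarith
  · have h0 : x ≤ γ⁻¹ * e := by
      rw [inv_mul_eq_div, le_div_iff₀ hγ]
      linarith
    have h1 : x ^ t * e ≤ (γ⁻¹ * e) ^ t * e := by gcongr
    have h2 : 0 ≤ γ * x ^ (t + 1) := by positivity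
    have h3 : (γ⁻¹ * e) ^ t * e = γ⁻¹ ^ t * e ^ (t + 1) := by ring
    linarith

end RealInequalities

/-! ### Pathwise bounds for queues, their deviation from the mean, and estimation errors. -/

section Dynamics

variable {M N : ℕ}

/-- Error of the estimate of server `n` at dispatcher `m`. -/
def estError (z : State M N) (m : Fin M) (n : Fin N) : ℝ :=
  |(z.queue n : ℝ) - (z.est m n : ℝ)|

theorem estError_nonneg (z : State M N) (m : Fin M) (n : Fin N) : 0 ≤ estError z m n :=
  abs_nonneg _

theorem nextQueue_eq_max (z : State M N) (w : Slot M N) (n : Fin N) :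
    (nextQueue z w n : ℝ)
      = max ((z.queue n : ℝ) + routed w.arr w.choice n - w.serv n) 0 := by
  unfold nextQueue unused
  rcases le_total (w.serv n) (z.queue n + routed w.arr w.choice n) with h | h
  · have h' : (w.serv n : ℝ) ≤ z.queue n + routed w.arr w.choice n := by exact_mod_cast h
    rw [Nat.sub_eq_zero_of_le h, add_zero, Nat.cast_sub h, max_eq_left (by linarith)]
    push_cast
    ring
  · have h' : (z.queue n : ℝ) + routed w.arr w.choice n ≤ w.serv n := by exact_mod_cast h
    rw [Nat.add_sub_cancel' h, max_eq_right (by linarith)]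
    simp

theorem le_nextQueue (z : State M N) (w : Slot M N) (n : Fin N) :
    (z.queue n : ℝ) + routed w.arr w.choice n - w.serv n ≤ nextQueue z w n := by
  rw [nextQueue_eq_max]
  exact le_max_left _ _

theorem nextQueue_sq_le (z : State M N) (w : Slot M N) (n : Fin N) :
    (nextQueue z w n : ℝ) ^ 2
      ≤ ((z.queue n : ℝ) + routed w.arr w.choice n - w.serv n) ^ 2 := by
  rw [nextQueue_eq_max]
  rcases le_total ((z.queue n : ℝ) + routed w.arr w.choice n - w.serv n) 0 with h | h
  · rw [max_eq_right h]
    nlinarith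
  · rw [max_eq_left h]

theorem abs_nextQueue_sub_le (z : State M N) (w : Slot M N) (n : Fin N) :
    |(nextQueue z w n : ℝ) - z.queue n| ≤ routed w.arr w.choice n + w.serv n := by
  have hq : (0 : ℝ) ≤ z.queue n := by positivity
  have hr : (0 : ℝ) ≤ routed w.arr w.choice n := by positivity
  have hs : (0 : ℝ) ≤ w.serv n := by positivity
  rw [nextQueue_eq_max, abs_le]
  rcases le_total ((z.queue n : ℝ) + routed w.arr w.choice n - w.serv n) 0 with h | h
  · rw [max_eq_right h]
    constructor <;> linarith
  · rw [max_eq_left h]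
    constructor <;> linarith

theorem sum_routed (a : Fin M → ℕ) (d : Fin M → Fin N) : ∑ n, routed a d n = ∑ m, a m := by
  unfold routed
  rw [Finset.sum_comm]
  refine Finset.sum_congr rfl fun m _ => ?_
  simp [sent]

theorem sum_routed_add_serv (w : Slot M N) :
    ∑ n, ((routed w.arr w.choice n : ℝ) + w.serv n) = slotLoad w := by
  rw [Finset.sum_add_distrib, slotLoad, ← sum_routed w.arr w.choice]
  push_cast
  rfl

theorem routed_add_serv_le (w : Slot M N) (n : Fin N) :
    (routed w.arr w.choice n : ℝ) + w.serv n ≤ slotLoad w := by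
  rw [← sum_routed_add_serv]
  exact Finset.single_le_sum (f := fun n => (routed w.arr w.choice n : ℝ) + w.serv n)
    (fun _ _ => by positivity) (Finset.mem_univ n)

theorem sum_sq_routed_sub_serv_le (w : Slot M N) :
    ∑ n, ((routed w.arr w.choice n : ℝ) - w.serv n) ^ 2 ≤ slotLoad w ^ 2 := by
  have h1 : ∀ n ∈ Finset.univ, ((routed w.arr w.choice n : ℝ) - w.serv n) ^ 2
      ≤ ((routed w.arr w.choice n : ℝ) + w.serv n) * slotLoad w := by
    intro n _
    have hr : (0 : ℝ) ≤ routed w.arr w.choice n := by positivity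
    have hs : (0 : ℝ) ≤ w.serv n := by positivity
    have := routed_add_serv_le w n
    nlinarith [mul_nonneg hr hs]
  refine (Finset.sum_le_sum h1).trans ?_
  rw [← Finset.sum_mul, sum_routed_add_serv, sq]

theorem sum_nextQueue_sq_le (z : State M N) (w : Slot M N) :
    ∑ n, (nextQueue z w n : ℝ) ^ 2 ≤ ∑ n, (z.queue n : ℝ) ^ 2
      + 2 * ∑ n, (z.queue n : ℝ) * ((routed w.arr w.choice n : ℝ) - w.serv n)
      + slotLoad w ^ 2 := by
  have h1 : ∑ n, (nextQueue z w n : ℝ) ^ 2 ≤ ∑ n, ((z.queue n : ℝ) ^ 2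
      + 2 * ((z.queue n : ℝ) * ((routed w.arr w.choice n : ℝ) - w.serv n))
      + ((routed w.arr w.choice n : ℝ) - w.serv n) ^ 2) := by
    refine Finset.sum_le_sum fun n _ => (nextQueue_sq_le z w n).trans (le_of_eq (by ring))
  rw [Finset.sum_add_distrib, Finset.sum_add_distrib, ← Finset.mul_sum] at h1
  linarith [sum_sq_routed_sub_serv_le w]

/-- Mean queue length over the servers. -/
noncomputable def queueMean (z : State M N) : ℝ := (∑ n, (z.queue n : ℝ)) / N

theorem queuePerp_apply (hN : 0 < N) (z : State M N) (n : Fin N) :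
    queuePerp z n = z.queue n - queueMean z := by
  have hN' : (0 : ℝ) < N := by exact_mod_cast hN
  have hs : Real.sqrt N * Real.sqrt N = N := Real.mul_self_sqrt hN'.le
  have hs0 : Real.sqrt N ≠ 0 := (Real.sqrt_pos.2 hN').ne'
  simp only [queuePerp, queueVec, diagDir, queueMean, PiLp.sub_apply, PiLp.smul_apply,
    PiLp.inner_apply, smul_eq_mul, RCLike.inner_apply, conj_trivial]
  rw [← Finset.mul_sum]
  congr 1
  rw [mul_right_comm]
  field_simp
  rw [sq, hs, mul_comm]

theorem norm_queuePerp_sq (hN : 0 < N) (z : State M N) :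
    ‖queuePerp z‖ ^ 2 = ∑ n, ((z.queue n : ℝ) - queueMean z) ^ 2 := by
  rw [EuclideanSpace.norm_sq_eq]
  exact Finset.sum_congr rfl fun n _ => by rw [queuePerp_apply hN, Real.norm_eq_abs, sq_abs]

theorem sum_queue_sub_mean (hN : 0 < N) (z : State M N) :
    ∑ n, ((z.queue n : ℝ) - queueMean z) = 0 := by
  have hN' : (N : ℝ) ≠ 0 := by exact_mod_cast hN.ne'
  simp only [Finset.sum_sub_distrib, Finset.sum_const, Finset.card_univ, Fintype.card_fin,
    nsmul_eq_mul, queueMean]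
  field_simp
  ring

theorem norm_queuePerp_sq' (hN : 0 < N) (z : State M N) :
    ‖queuePerp z‖ ^ 2 = ∑ n, (z.queue n : ℝ) ^ 2 - queueMean z * ∑ n, (z.queue n : ℝ) := by
  rw [norm_queuePerp_sq hN]
  have h := sum_queue_sub_mean hN z
  have : ∀ n, ((z.queue n : ℝ) - queueMean z) ^ 2 = (z.queue n : ℝ) ^ 2
      - queueMean z * z.queue n - queueMean z * ((z.queue n : ℝ) - queueMean z) := by
    intro n
    ring
  simp only [this]
  rw [Finset.sum_sub_distrib, Finset.sum_sub_distrib, ← Finset.mul_sum, ← Finset.mul_sum, h]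
  ring

/-- Orthogonal projection does not increase norms, and the Euclidean norm of the queue increments is
at most the sum of their absolute values, hence at most the load. -/
theorem abs_norm_queuePerp_sub_le (hN : 0 < N) (z : State M N) (w : Slot M N) :
    |‖queuePerp (nextState z w)‖ - ‖queuePerp z‖| ≤ slotLoad w := by
  have hN' : (0 : ℝ) < N := by exact_mod_cast hN
  refine (abs_norm_sub_norm_le _ _).trans ?_
  set v : Fin N → ℝ := fun n => (nextQueue z w n : ℝ) - z.queue n with hv
  have hm : queueMean (nextState z w) - queueMean z = (∑ n, v n) / N := by
    simp only [queueMean, hv, Finset.sum_sub_distrib, sub_div]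
    rfl
  have hcoord : ∀ n, (queuePerp (nextState z w) - queuePerp z) n = v n - (∑ n, v n) / N := by
    intro n
    rw [PiLp.sub_apply, queuePerp_apply hN, queuePerp_apply hN, ← hm]
    simp only [hv, nextState]
    ring
  have hvJ : ∑ n, |v n| ≤ slotLoad w := by
    rw [← sum_routed_add_serv]
    exact Finset.sum_le_sum fun n _ => abs_nextQueue_sub_le z w n
  have hsq : ‖queuePerp (nextState z w) - queuePerp z‖ ^ 2 ≤ slotLoad w ^ 2 := by
    rw [EuclideanSpace.norm_sq_eq]
    simp only [hcoord, Real.norm_eq_abs, sq_abs]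
    have e : ∑ n, (v n - (∑ n, v n) / N) ^ 2 = ∑ n, v n ^ 2 - (∑ n, v n) ^ 2 / N := by
      have : ∀ n, (v n - (∑ n, v n) / N) ^ 2
          = v n ^ 2 - 2 * ((∑ n, v n) / N) * v n + ((∑ n, v n) / N) ^ 2 := fun n => by ring
      simp only [this]
      rw [Finset.sum_add_distrib, Finset.sum_sub_distrib, ← Finset.mul_sum]
      simp only [Finset.sum_const, Finset.card_univ, Fintype.card_fin, nsmul_eq_mul]
      field_simp
      ring
    rw [e]
    have h1 : ∑ n, v n ^ 2 ≤ ∑ n, |v n| * slotLoad w := by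
      refine Finset.sum_le_sum fun n _ => ?_
      rw [← sq_abs, sq]
      gcongr
      exact (Finset.single_le_sum (f := fun n => |v n|) (fun _ _ => abs_nonneg _)
        (Finset.mem_univ n)).trans hvJ
    rw [← Finset.sum_mul] at h1
    have h2 : (∑ n, |v n|) * slotLoad w ≤ slotLoad w * slotLoad w := by
      gcongr
      exact slotLoad_nonneg w
    have h3 : 0 ≤ (∑ n, v n) ^ 2 / N := by positivity
    nlinarith
  exact (sq_le_sq₀ (norm_nonneg _) (slotLoad_nonneg w)).1 hsq

/-- Unused service needs no separate estimate. With `‖Q_⊥‖² = ∑ Q² - (∑ Q)² / N`, truncation at zero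
can only lower the squares, and can only raise the total, which enters with a minus sign. -/
theorem norm_queuePerp_sq_next_le (hN : 0 < N) (z : State M N) (w : Slot M N) :
    ‖queuePerp (nextState z w)‖ ^ 2 - ‖queuePerp z‖ ^ 2
      ≤ 2 * ∑ n, ((z.queue n : ℝ) - queueMean z) * ((routed w.arr w.choice n : ℝ) - w.serv n)
        + slotLoad w ^ 2 := by
  have hN' : (0 : ℝ) < N := by exact_mod_cast hN
  rw [norm_queuePerp_sq' hN, norm_queuePerp_sq' hN]
  have h1 := sum_nextQueue_sq_le z w
  set a := ∑ n, (z.queue n : ℝ) with ha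
  set b := ∑ n, (nextQueue z w n : ℝ) with hb
  have hqa : queueMean z = a / N := rfl
  have hqb : queueMean (nextState z w) = b / N := rfl
  have hbs : ∑ n, ((nextState z w).queue n : ℝ) = b := rfl
  have hbs2 : ∑ n, ((nextState z w).queue n : ℝ) ^ 2 = ∑ n, (nextQueue z w n : ℝ) ^ 2 := rfl
  have ha0 : 0 ≤ a := by positivity
  have hba : a + ∑ n, ((routed w.arr w.choice n : ℝ) - w.serv n) ≤ b := by
    rw [ha, hb, ← Finset.sum_add_distrib]
    refine Finset.sum_le_sum fun n _ => ?_
    linarith [le_nextQueue z w n]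
  set ρ := ∑ n, ((routed w.arr w.choice n : ℝ) - w.serv n) with hρ
  have h2 : ∑ n, ((z.queue n : ℝ) - queueMean z) * ((routed w.arr w.choice n : ℝ) - w.serv n)
      = ∑ n, (z.queue n : ℝ) * ((routed w.arr w.choice n : ℝ) - w.serv n) - a / N * ρ := by
    simp only [sub_mul, Finset.sum_sub_distrib]
    rw [← Finset.mul_sum, hqa]
  rw [hbs, hbs2, h2, hqa, hqb]
  -- This is `b² ≥ a² + 2 a (b - a) ≥ a² + 2 a ρ`, where `a ≥ 0` and `b - a ≥ ρ`.
  have h3 : a / N * a + 2 * (a / N * ρ) ≤ b / N * b := by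
    have e1 : a / N * a + 2 * (a / N * ρ) = (a * a + 2 * (a * ρ)) / N := by ring
    have e2 : b / N * b = (b * b) / N := by ring
    rw [e1, e2]
    gcongr
    nlinarith [sq_nonneg (b - a), mul_le_mul_of_nonneg_left hba ha0]
  linarith

variable {arrival : PMF (Fin M → ℕ)} {service : Fin N → PMF ℕ} {pol : Policy M N}

theorem incr_le_of_mem_support {z : State M N} {w : Slot M N}
    (hw : w ∈ (slotLaw arrival service pol z).support) (m : Fin M) (n : Fin N) :
    w.upd.incr m n ≤ sent w.arr w.choice m n := by
  simp only [slotLaw, PMF.mem_support_bind_iff, PMF.mem_support_map_iff] at hw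
  obtain ⟨a, -, d, -, s, -, u, hu, rfl⟩ := hw
  exact pol.incr_le z a d s u hu m n

/-- Without synchronization the queue moves within `[-S, A]` and the estimate within `[0, A]`, so
their difference changes by at most `A + S`. -/
theorem estError_next_le {z : State M N} {w : Slot M N}
    (hw : w ∈ (slotLaw arrival service pol z).support) (m : Fin M) (n : Fin N) :
    estError (nextState z w) m n
      ≤ if w.upd.sync m n then 0 else estError z m n + slotLoad w := by
  unfold estError
  split_ifs with h
  · simp [nextState, h]
  · simp only [nextState, h]
    push_cast
    have h1 := incr_le_of_mem_support hw m n
    have h1' : (w.upd.incr m n : ℝ) ≤ routed w.arr w.choice n := by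
      have : sent w.arr w.choice m n ≤ routed w.arr w.choice n :=
        Finset.single_le_sum (f := fun m => sent w.arr w.choice m n)
          (fun _ _ => Nat.zero_le _) (Finset.mem_univ m)
      exact_mod_cast h1.trans this
    have h0 : (0 : ℝ) ≤ w.upd.incr m n := by positivity
    have h2 := routed_add_serv_le w n
    have hs : (0 : ℝ) ≤ w.serv n := by positivity
    have hr : (0 : ℝ) ≤ routed w.arr w.choice n := by positivity
    have h5 : |(nextQueue z w n : ℝ) - z.queue n - w.upd.incr m n| ≤ slotLoad w := by
      have hq : (0 : ℝ) ≤ z.queue n := by positivity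
      rw [nextQueue_eq_max, abs_le]
      rcases le_total ((z.queue n : ℝ) + routed w.arr w.choice n - w.serv n) 0 with h | h
      · rw [max_eq_right h]
        constructor <;> linarith
      · rw [max_eq_left h]
        constructor <;> linarith
    have e : (nextQueue z w n : ℝ) - (z.est m n + w.upd.incr m n)
        = ((z.queue n : ℝ) - z.est m n)
          + ((nextQueue z w n : ℝ) - z.queue n - w.upd.incr m n) := by ring
    rw [e]
    exact (abs_add_le _ _).trans (by gcongr)

end Dynamics

/-! ### Negative correlation between tilted preferences and queue lengths. -/

section Tilt

variable {N : ℕ}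

/-- Since the preferences sum to zero, a pivot can be subtracted from the estimates; then every term
is nonpositive and the two extreme ones give `-δ` times the spread. Arbitrary `i`, `j` allow all
dispatchers to use the same pair of servers despite their different orderings. -/
theorem sum_mul_le_of_tilted {est Δ : Fin N → ℝ} {δ : ℝ} {k : ℕ} (hk : 2 ≤ k) (hkN : k ≤ N)
    (σ : Equiv.Perm (Fin N)) (hmono : Monotone (est ∘ σ)) (hsum : ∑ n, Δ n = 0)
    (hpos : ∀ i : Fin N, (i : ℕ) + 1 < k → 0 ≤ Δ (σ i))
    (hneg : ∀ i : Fin N, k ≤ (i : ℕ) + 1 → Δ (σ i) ≤ 0)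
    (hfirst : ∀ i : Fin N, (i : ℕ) + 1 = 1 → δ ≤ Δ (σ i))
    (hlast : ∀ i : Fin N, (i : ℕ) + 1 = N → Δ (σ i) ≤ -δ) (hδ : 0 ≤ δ) (i j : Fin N) :
    ∑ n, est n * Δ n ≤ -δ * (est i - est j) := by
  set i₀ : Fin N := ⟨0, by omega⟩ with hi₀
  set i₁ : Fin N := ⟨N - 1, by omega⟩ with hi₁
  -- The pivot is the estimate at one-based position `k`, where the preference changes sign.
  set c := est (σ ⟨k - 1, by omega⟩) with hc
  have hne : i₀ ≠ i₁ := by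
    intro h
    have := congrArg Fin.val h
    simp [hi₀, hi₁] at this
    omega
  have hc_lt : ∀ i : Fin N, (i : ℕ) + 1 < k → est (σ i) ≤ c := fun i hi =>
    hmono (show i ≤ ⟨k - 1, _⟩ from Fin.le_def.2 (by simp; omega))
  have hc_ge : ∀ i : Fin N, k ≤ (i : ℕ) + 1 → c ≤ est (σ i) := fun i hi =>
    hmono (show (⟨k - 1, by omega⟩ : Fin N) ≤ i from Fin.le_def.2 (by simp; omega))
  have e1 : ∑ n, est n * Δ n = ∑ i, (est (σ i) - c) * Δ (σ i) := by
    rw [Equiv.sum_comp σ fun n => (est n - c) * Δ n]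
    simp only [sub_mul, Finset.sum_sub_distrib]
    rw [← Finset.mul_sum, hsum]
    ring
  have e2 : ∀ i : Fin N, (est (σ i) - c) * Δ (σ i)
      ≤ (if i = i₀ then δ * (est (σ i₀) - c) else 0)
        + (if i = i₁ then -δ * (est (σ i₁) - c) else 0) := by
    intro i
    by_cases h0 : i = i₀
    · have h1 : i ≠ i₁ := h0 ▸ hne
      simp only [h0, if_true, hne, if_false, add_zero]
      have hf := hfirst i₀ (by simp [hi₀])
      have hl := hc_lt i₀ (by simp [hi₀]; omega)
      nlinarith
    · by_cases h1 : i = i₁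
      · simp only [h1, if_true, hne.symm, if_false, zero_add]
        have hf := hlast i₁ (by simp [hi₁]; omega)
        have hl := hc_ge i₁ (by simp [hi₁]; omega)
        nlinarith
      · simp only [h0, h1, if_false, add_zero]
        rcases lt_or_ge ((i : ℕ) + 1) k with h | h
        · exact mul_nonpos_of_nonpos_of_nonneg (by linarith [hc_lt i h]) (hpos i h)
        · exact mul_nonpos_of_nonneg_of_nonpos (by linarith [hc_ge i h]) (hneg i h)
  have e3 := Finset.sum_le_sum fun i (_ : i ∈ Finset.univ) => e2 i
  rw [Finset.sum_add_distrib, Finset.sum_ite_eq', Finset.sum_ite_eq'] at e3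
  simp only [Finset.mem_univ, if_true] at e3
  have hmin : est (σ i₀) ≤ est j := by
    have : est (σ i₀) ≤ est (σ (σ.symm j)) := hmono (Fin.le_def.2 (by simp [hi₀]))
    simpa using this
  have hmax : est i ≤ est (σ i₁) := by
    have : est (σ (σ.symm i)) ≤ est (σ i₁) :=
      hmono (Fin.le_def.2 (by simp only [hi₁]; omega))
    simpa using this
  rw [e1]
  nlinarith

/-- Replacing estimates by queues costs one total error in the sum, as `|Δ n| ≤ 1`, and `δ` times it
at each of `i` and `j`. -/
theorem sum_queue_mul_le {q est Δ : Fin N → ℝ} {δ : ℝ} (hδ : 0 ≤ δ)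
    (hΔ : ∀ n, |Δ n| ≤ 1) (i j : Fin N)
    (h : ∑ n, est n * Δ n ≤ -δ * (est i - est j)) :
    ∑ n, q n * Δ n ≤ -δ * (q i - q j) + (1 + 2 * δ) * ∑ n, |q n - est n| := by
  have h1 : ∑ n, q n * Δ n = ∑ n, est n * Δ n + ∑ n, (q n - est n) * Δ n := by
    rw [← Finset.sum_add_distrib]
    exact Finset.sum_congr rfl fun n _ => by ring
  have h2 : ∑ n, (q n - est n) * Δ n ≤ ∑ n, |q n - est n| := by
    refine Finset.sum_le_sum fun n _ => (le_abs_self _).trans ?_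
    rw [abs_mul]
    exact mul_le_of_le_one_right (abs_nonneg _) (hΔ n)
  have hs : ∀ l, |q l - est l| ≤ ∑ n, |q n - est n| := fun l =>
    Finset.single_le_sum (f := fun n => |q n - est n|) (fun _ _ => abs_nonneg _)
      (Finset.mem_univ l)
  have hi := (le_abs_self _).trans (hs i)
  have hj := (neg_le_abs _).trans (hs j)
  rw [h1]
  nlinarith

end Tilt

/-! ### Conditional mean drift in one slot. -/

section MeanDrift

variable {M N : ℕ} {arrival : PMF (Fin M → ℕ)} {service : Fin N → PMF ℕ} {pol : Policy M N}
  {z : State M N} {θ₁ θ₂ D₁ D₂ ε δ p : ℝ}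

theorem sum_toReal_pmf (P : PMF (Fin N)) : ∑ n, (P n).toReal = 1 := by
  have h := P.tsum_coe
  rw [tsum_fintype] at h
  rw [← ENNReal.toReal_sum fun n _ => P.apply_ne_top n, h, ENNReal.toReal_one]

theorem totalServiceRate_pos (hN : 0 < N) (hrate : ∀ n, 0 < serviceRate service n) :
    0 < totalServiceRate service :=
  Finset.sum_pos (fun n _ => hrate n) ⟨⟨0, hN⟩, Finset.mem_univ _⟩

theorem serviceRate_le_total (hrate : ∀ n, 0 < serviceRate service n) (n : Fin N) :
    serviceRate service n ≤ totalServiceRate service :=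
  Finset.single_le_sum (f := serviceRate service) (fun n _ => (hrate n).le) (Finset.mem_univ n)

theorem sum_queue_mul_preference_le (hN : 0 < N) (hrate : ∀ n, 0 < serviceRate service n)
    (hδ : 0 < δ) {m : Fin M} (htilt : IsDeltaTilted arrival service pol δ m)
    (hz : Reachable arrival service pol z) (i j : Fin N) :
    ∑ n, (z.queue n : ℝ) * ((pol.dispatch m (z.est m) n).toReal
        - serviceRate service n / totalServiceRate service)
      ≤ -δ * ((z.queue i : ℝ) - z.queue j) + (1 + 2 * δ) * ∑ n, estError z m n := by
  obtain ⟨k, hk, hkN, h⟩ := htilt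
  obtain ⟨σ, hmono, hσ⟩ := h z hz
  have hμ := totalServiceRate_pos hN hrate
  refine sum_queue_mul_le (est := fun n => (z.est m n : ℝ)) hδ.le (fun n => ?_) i j
    (sum_mul_le_of_tilted hk hkN σ (fun a b hab => Nat.cast_le.2 (hmono hab)) ?_
      (fun i => (hσ i).1) (fun i => (hσ i).2.1) (fun i => (hσ i).2.2.1)
      (fun i => (hσ i).2.2.2) hδ.le i j)
  · have h1 : ((pol.dispatch m (z.est m)) n).toReal ≤ 1 :=
      ENNReal.toReal_le_of_le_ofReal zero_le_one (by simpa using PMF.coe_le_one _ _)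
    have h2 : 0 ≤ ((pol.dispatch m (z.est m)) n).toReal := ENNReal.toReal_nonneg
    have h3 : serviceRate service n / totalServiceRate service ≤ 1 :=
      (div_le_one hμ).2 (serviceRate_le_total hrate n)
    have h4 : 0 ≤ serviceRate service n / totalServiceRate service :=
      div_nonneg (hrate n).le hμ.le
    rw [abs_le]
    constructor <;> linarith
  · rw [Finset.sum_sub_distrib, sum_toReal_pmf, ← Finset.sum_div]
    change 1 - totalServiceRate service / totalServiceRate service = 0
    rw [div_self hμ.ne', sub_self]

/-- As the arrival rates add up to `μ - ε`, the mean of `A_n - S_n` is the rate-weighted sum of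
preferences minus `ε μ_n / μ`. The preferences have zero sum, so `τ` survives only in the slack
term; it will be the mean queue or zero. -/
theorem mean_drift_le (hN : 0 < N) (hrate : ∀ n, 0 < serviceRate service n)
    (hδ : 0 < δ) (hθ₁ : 0 < θ₁) (hε : 0 < ε) (harr : IsArrivalLaw service θ₁ D₁ ε arrival)
    (htilt : ∀ m, IsDeltaTilted arrival service pol δ m)
    (hz : Reachable arrival service pol z) (τ : ℝ) (i j : Fin N) :
    ∑ n, ((z.queue n : ℝ) - τ) * (∑ m, arrivalRate arrival m
        * (pol.dispatch m (z.est m) n).toReal - serviceRate service n)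
      ≤ -δ * (totalServiceRate service - ε) * ((z.queue i : ℝ) - z.queue j)
        + (1 + 2 * δ) * totalServiceRate service
          * ∑ a : Fin M × Fin N, estError z a.1 a.2
        - ε / totalServiceRate service
          * ∑ n, ((z.queue n : ℝ) - τ) * serviceRate service n := by
  set μ := totalServiceRate service with hμdef
  have hμ : 0 < μ := totalServiceRate_pos hN hrate
  have hsum : ∑ m, arrivalRate arrival m = μ - ε :=
    (sum_arrivalRate hθ₁ harr).trans harr.rate
  have hmass : ∀ m, ∑ n, ((pol.dispatch m (z.est m) n).toReal - serviceRate service n / μ) = 0 := by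
    intro m
    rw [Finset.sum_sub_distrib, sum_toReal_pmf, ← Finset.sum_div]
    change 1 - μ / μ = 0
    rw [div_self hμ.ne', sub_self]
  have key : ∑ n, ((z.queue n : ℝ) - τ) * (∑ m, arrivalRate arrival m
        * (pol.dispatch m (z.est m) n).toReal - serviceRate service n)
      = ∑ m, arrivalRate arrival m * ∑ n, (z.queue n : ℝ)
          * ((pol.dispatch m (z.est m) n).toReal - serviceRate service n / μ)
        - ε / μ * ∑ n, ((z.queue n : ℝ) - τ) * serviceRate service n := by
    have e1 : ∀ m, ∑ n, (z.queue n : ℝ)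
          * ((pol.dispatch m (z.est m) n).toReal - serviceRate service n / μ)
        = ∑ n, ((z.queue n : ℝ) - τ)
          * ((pol.dispatch m (z.est m) n).toReal - serviceRate service n / μ) := by
      intro m
      simp only [sub_mul _ τ, Finset.sum_sub_distrib (f := fun n => (z.queue n : ℝ) * _)]
      rw [← Finset.mul_sum, hmass, mul_zero, sub_zero]
    simp only [e1, Finset.mul_sum]
    rw [Finset.sum_comm, ← Finset.sum_sub_distrib]
    refine Finset.sum_congr rfl fun n _ => ?_
    have e2 : ∑ m, arrivalRate arrival m * (((z.queue n : ℝ) - τ)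
          * ((pol.dispatch m (z.est m) n).toReal - serviceRate service n / μ))
        = ((z.queue n : ℝ) - τ) * (∑ m, arrivalRate arrival m
          * (pol.dispatch m (z.est m) n).toReal
          - (∑ m, arrivalRate arrival m) * (serviceRate service n / μ)) := by
      rw [mul_sub, Finset.mul_sum, Finset.sum_mul, Finset.mul_sum, ← Finset.sum_sub_distrib]
      exact Finset.sum_congr rfl fun m _ => by ring
    rw [e2, hsum]
    field_simp
    ring
  rw [key]
  have hlam : ∀ m, arrivalRate arrival m ≤ μ := fun m =>
    (Finset.single_le_sum (f := arrivalRate arrival)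
      (fun m _ => arrivalRate_nonneg arrival m) (Finset.mem_univ m)).trans (by linarith)
  have h1 : ∑ m, arrivalRate arrival m * ∑ n, (z.queue n : ℝ)
          * ((pol.dispatch m (z.est m) n).toReal - serviceRate service n / μ)
      ≤ ∑ m, (arrivalRate arrival m * (-δ * ((z.queue i : ℝ) - z.queue j))
        + (1 + 2 * δ) * μ * ∑ n, estError z m n) := by
    refine Finset.sum_le_sum fun m _ => ?_
    have h2 := mul_le_mul_of_nonneg_left
      (sum_queue_mul_preference_le hN hrate hδ (htilt m) hz i j) (arrivalRate_nonneg arrival m)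
    have h3 : 0 ≤ (1 + 2 * δ) * ∑ n, estError z m n :=
      mul_nonneg (by linarith) (Finset.sum_nonneg fun n _ => estError_nonneg z m n)
    have h4 := mul_le_mul_of_nonneg_right (hlam m) h3
    rw [← hμdef] at h2
    linarith
  rw [Finset.sum_add_distrib, ← Finset.sum_mul, hsum, ← Finset.mul_sum,
    ← Fintype.sum_prod_type' (f := fun m n => estError z m n)] at h1
  linarith

/-- Let `s` be the queue spread. After doubling, the tilt gives at most `-δ μ s` because `ε ≤ μ /
2`, and the slack costs at most `2 ε s ≤ δ μ s / 2`. The remaining `-δ μ s / 2` is compared with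
`‖Q_⊥‖ ≤ N s`. -/
theorem perp_mean_drift_le (hN : 0 < N) (hrate : ∀ n, 0 < serviceRate service n)
    (hδ : 0 < δ) (hθ₁ : 0 < θ₁) (hε : 0 < ε) (hε₁ : ε ≤ totalServiceRate service / 2)
    (hε₂ : ε ≤ δ * totalServiceRate service / 4)
    (harr : IsArrivalLaw service θ₁ D₁ ε arrival)
    (htilt : ∀ m, IsDeltaTilted arrival service pol δ m)
    (hz : Reachable arrival service pol z) :
    2 * ∑ n, ((z.queue n : ℝ) - queueMean z) * (∑ m, arrivalRate arrival m
        * (pol.dispatch m (z.est m) n).toReal - serviceRate service n)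
      ≤ -(δ * totalServiceRate service / (2 * N)) * ‖queuePerp z‖
        + 2 * (1 + 2 * δ) * totalServiceRate service
          * ∑ a : Fin M × Fin N, estError z a.1 a.2 := by
  have hN' : (0 : ℝ) < N := by exact_mod_cast hN
  have hμ : 0 < totalServiceRate service := totalServiceRate_pos hN hrate
  obtain ⟨i, -, hi⟩ := Finset.exists_max_image Finset.univ (fun n => (z.queue n : ℝ))
    ⟨⟨0, hN⟩, Finset.mem_univ _⟩
  obtain ⟨j, -, hj⟩ := Finset.exists_min_image Finset.univ (fun n => (z.queue n : ℝ))
    ⟨⟨0, hN⟩, Finset.mem_univ _⟩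
  simp only [Finset.mem_univ, true_implies] at hi hj
  have hmean_le : queueMean z ≤ z.queue i := by
    rw [queueMean, div_le_iff₀ hN']
    refine (Finset.sum_le_sum fun n _ => hi n).trans (le_of_eq ?_)
    simp [mul_comm]
  have hle_mean : (z.queue j : ℝ) ≤ queueMean z := by
    rw [queueMean, le_div_iff₀ hN']
    refine le_trans (le_of_eq ?_) (Finset.sum_le_sum fun n _ => hj n)
    simp [mul_comm]
  set s : ℝ := (z.queue i : ℝ) - z.queue j with hs
  have hs0 : 0 ≤ s := by
    have := hi j
    linarith
  have hdev : ∀ n, |(z.queue n : ℝ) - queueMean z| ≤ s := by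
    intro n
    rw [abs_le]
    constructor <;> linarith [hi n, hj n]
  have hx : ‖queuePerp z‖ ≤ N * s := by
    refine (sq_le_sq₀ (norm_nonneg _) (by positivity)).1 ?_
    rw [norm_queuePerp_sq hN]
    have h1 : ∑ n, ((z.queue n : ℝ) - queueMean z) ^ 2 ≤ ∑ _n : Fin N, s ^ 2 := by
      refine Finset.sum_le_sum fun n _ => ?_
      rw [← sq_abs]
      gcongr
      exact hdev n
    simp only [Finset.sum_const, Finset.card_univ, Fintype.card_fin, nsmul_eq_mul] at h1
    have h2 : (1 : ℝ) ≤ N := by exact_mod_cast hN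
    nlinarith [mul_nonneg (sub_nonneg.2 h2) (mul_nonneg hN'.le (sq_nonneg s))]
  have hserv : -(ε / totalServiceRate service)
      * ∑ n, ((z.queue n : ℝ) - queueMean z) * serviceRate service n ≤ ε * s := by
    have h1 : -(totalServiceRate service * s)
        ≤ ∑ n, ((z.queue n : ℝ) - queueMean z) * serviceRate service n := by
      rw [totalServiceRate, Finset.sum_mul, ← Finset.sum_neg_distrib]
      refine Finset.sum_le_sum fun n _ => ?_
      nlinarith [(abs_le.1 (hdev n)).1, hrate n]
    have h2 : 0 ≤ ε / totalServiceRate service := by positivity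
    have h3 := mul_le_mul_of_nonneg_left h1 h2
    have h4 : ε / totalServiceRate service * -(totalServiceRate service * s) = -(ε * s) := by
      field_simp
    linarith
  have h := mean_drift_le hN hrate hδ hθ₁ hε harr htilt hz (queueMean z) i j
  rw [← hs] at h
  have h5 : δ * totalServiceRate service / (2 * N) * ‖queuePerp z‖
      ≤ δ * totalServiceRate service / 2 * s := by
    calc _ ≤ δ * totalServiceRate service / (2 * N) * (N * s) := by gcongr
      _ = _ := by field_simp
  have h6 : δ * (totalServiceRate service / 2) * s
      ≤ δ * (totalServiceRate service - ε) * s := by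
    gcongr
    linarith
  have h7 : ε * s ≤ δ * totalServiceRate service / 4 * s := by gcongr
  linarith

variable (arrival service pol z)

theorem integrable_routed_sub_serv (hθ₁ : 0 < θ₁) (hθ₂ : 0 < θ₂)
    (harr : IsArrivalLaw service θ₁ D₁ ε arrival)
    (htail : ∀ n, expect (service n) (fun s => ENNReal.ofReal (Real.exp (θ₂ * (s : ℝ))))
      ≤ ENNReal.ofReal D₂) (n : Fin N) :
    Integrable (fun w => (routed w.arr w.choice n : ℝ) - w.serv n)
        (slotLaw arrival service pol z).toMeasure := by
  refine Integrable.sub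
    (integrable_of_le_slotLoad arrival service pol z hθ₁ hθ₂ harr htail
      (fun w => by positivity) fun w => ?_)
    (integrable_of_le_slotLoad arrival service pol z hθ₁ hθ₂ harr htail
      (fun w => by positivity) fun w => serv_le_slotLoad w n)
  have h1 := routed_add_serv_le w n
  have h2 : (0 : ℝ) ≤ w.serv n := by positivity
  linarith

theorem integral_routed_sub_serv (hθ₁ : 0 < θ₁) (hθ₂ : 0 < θ₂)
    (harr : IsArrivalLaw service θ₁ D₁ ε arrival)
    (htail : ∀ n, expect (service n) (fun s => ENNReal.ofReal (Real.exp (θ₂ * (s : ℝ))))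
      ≤ ENNReal.ofReal D₂) (n : Fin N) :
    ∫ w, ((routed w.arr w.choice n : ℝ) - w.serv n) ∂(slotLaw arrival service pol z).toMeasure
      = ∑ m, arrivalRate arrival m * (pol.dispatch m (z.est m) n).toReal
        - serviceRate service n := by
  have hsent : ∀ m, Integrable (fun w => (sent w.arr w.choice m n : ℝ))
      (slotLaw arrival service pol z).toMeasure := fun m =>
    integrable_of_le_slotLoad arrival service pol z hθ₁ hθ₂ harr htail
      (fun w => by positivity) fun w => sent_le_slotLoad w m n
  have hserv : Integrable (fun w => (w.serv n : ℝ))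
      (slotLaw arrival service pol z).toMeasure :=
    integrable_of_le_slotLoad arrival service pol z hθ₁ hθ₂ harr htail
      (fun w => by positivity) fun w => serv_le_slotLoad w n
  have e : ∀ w : Slot M N, (routed w.arr w.choice n : ℝ)
      = ∑ m, (sent w.arr w.choice m n : ℝ) := fun w => by simp [routed]
  simp only [e]
  rw [integral_sub (integrable_finsetSum _ fun m _ => hsent m) hserv,
    integral_finsetSum _ fun m _ => hsent m, integral_serv]
  congr 1
  exact Finset.sum_congr rfl fun m _ => integral_sent arrival service pol z m n

theorem integrable_sum_mul_routed_sub_serv (hθ₁ : 0 < θ₁) (hθ₂ : 0 < θ₂)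
    (harr : IsArrivalLaw service θ₁ D₁ ε arrival)
    (htail : ∀ n, expect (service n) (fun s => ENNReal.ofReal (Real.exp (θ₂ * (s : ℝ))))
      ≤ ENNReal.ofReal D₂) (y : Fin N → ℝ) :
    Integrable (fun w => ∑ n, y n * ((routed w.arr w.choice n : ℝ) - w.serv n))
        (slotLaw arrival service pol z).toMeasure :=
  integrable_finsetSum _ fun n _ =>
    (integrable_routed_sub_serv arrival service pol z hθ₁ hθ₂ harr htail n).const_mul _

theorem integral_sum_mul_routed_sub_serv (hθ₁ : 0 < θ₁) (hθ₂ : 0 < θ₂)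
    (harr : IsArrivalLaw service θ₁ D₁ ε arrival)
    (htail : ∀ n, expect (service n) (fun s => ENNReal.ofReal (Real.exp (θ₂ * (s : ℝ))))
      ≤ ENNReal.ofReal D₂) (y : Fin N → ℝ) :
    ∫ w, ∑ n, y n * ((routed w.arr w.choice n : ℝ) - w.serv n)
        ∂(slotLaw arrival service pol z).toMeasure
      = ∑ n, y n * (∑ m, arrivalRate arrival m * (pol.dispatch m (z.est m) n).toReal
        - serviceRate service n) := by
  rw [integral_finsetSum _ fun n _ =>
    (integrable_routed_sub_serv arrival service pol z hθ₁ hθ₂ harr htail n).const_mul _]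
  refine Finset.sum_congr rfl fun n _ => ?_
  rw [integral_const_mul, integral_routed_sub_serv arrival service pol z hθ₁ hθ₂ harr htail n]

end MeanDrift

/-! ### The two Lyapunov functions and their drift. -/

section Lyapunov

variable {M N : ℕ} {arrival : PMF (Fin M → ℕ)} {service : Fin N → PMF ℕ} {pol : Policy M N}
  {z : State M N} {θ₁ θ₂ D₁ D₂ ε δ p : ℝ}

/-- Common passage from a pathwise bound to a drift inequality: the linear term is integrated
exactly, load powers are replaced by moment bounds, and each factor for a missing synchronization by
`1 - p`. -/
theorem expect_next_le (hθ₁ : 0 < θ₁) (hθ₂ : 0 < θ₂)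
    (harr : IsArrivalLaw service θ₁ D₁ ε arrival)
    (htail : ∀ n, expect (service n) (fun s => ENNReal.ofReal (Real.exp (θ₂ * (s : ℝ))))
      ≤ ENNReal.ofReal D₂)
    (hupd : UpdatesWithProb arrival service pol p) (hz : Reachable arrival service pol z)
    {V : State M N → ℝ} (hV : ∀ z, 0 ≤ V z) {c₀ c₁ b₁ b₂ b₃ : ℝ} {k₁ k₂ k₃ : ℕ}
    {y : Fin N → ℝ} {v : Fin M × Fin N → ℝ} (hb₁ : 0 ≤ b₁) (hb₂ : 0 ≤ b₂) (hb₃ : 0 ≤ b₃)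
    (hv : ∀ a, 0 ≤ v a)
    (hle : ∀ w ∈ (slotLaw arrival service pol z).support, V (nextState z w) ≤
      c₀ + c₁ * ∑ n, y n * ((routed w.arr w.choice n : ℝ) - w.serv n)
        + (b₁ * slotLoad w ^ k₁ + b₂ * slotLoad w ^ k₂ + b₃ * slotLoad w ^ k₃)
        + ∑ a, v a * (1 - if w.upd.sync a.1 a.2 then 1 else 0))
    {f U : ℝ} (hf : 0 ≤ f)
    (hU : c₀ + c₁ * ∑ n, y n * (∑ m, arrivalRate arrival m
          * (pol.dispatch m (z.est m) n).toReal - serviceRate service n)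
        + (b₁ * loadMoment N θ₁ θ₂ D₁ D₂ k₁ + b₂ * loadMoment N θ₁ θ₂ D₁ D₂ k₂
          + b₃ * loadMoment N θ₁ θ₂ D₁ D₂ k₃)
        + ∑ a, v a * (1 - p) + f ≤ U) :
    expect (transition arrival service pol z) (fun z => ENNReal.ofReal (V z))
      + ENNReal.ofReal f ≤ ENNReal.ofReal U := by
  rw [transition, expect_map]
  set P := slotLaw arrival service pol z with hP
  have iJ := integrable_slotLoad_pow arrival service pol z hθ₁ hθ₂ harr htail
  have bJ := integral_slotLoad_pow_le arrival service pol z hθ₁ hθ₂ harr htail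
  have iY := integrable_sum_mul_routed_sub_serv arrival service pol z hθ₁ hθ₂ harr htail y
  have eY := integral_sum_mul_routed_sub_serv arrival service pol z hθ₁ hθ₂ harr htail y
  have iS : ∀ a : Fin M × Fin N, Integrable
      (fun w : Slot M N => 1 - (if w.upd.sync a.1 a.2 then 1 else 0 : ℝ)) P.toMeasure :=
    fun a => (integrable_const 1).sub (integrable_sync arrival service pol z a.1 a.2)
  have bS : ∀ a : Fin M × Fin N, ∫ w : Slot M N,
      (1 - (if w.upd.sync a.1 a.2 then 1 else 0 : ℝ)) ∂P.toMeasure ≤ 1 - p := by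
    intro a
    rw [integral_sub (integrable_const 1) (integrable_sync arrival service pol z a.1 a.2)]
    have := integral_sync_ge arrival service pol z hz hupd a.1 a.2
    simp only [integral_const, probReal_univ, smul_eq_mul, mul_one]
    linarith
  rw [← hP] at iJ bJ iY eY
  have i0 : Integrable (fun _ : Slot M N => c₀) P.toMeasure := integrable_const _
  have i1 := iY.const_mul c₁
  have j1 := (iJ k₁).const_mul b₁
  have j2 := (iJ k₂).const_mul b₂
  have j3 := (iJ k₃).const_mul b₃
  have i2 : Integrable (fun w : Slot M N => b₁ * slotLoad w ^ k₁ + b₂ * slotLoad w ^ k₂)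
    P.toMeasure := j1.add j2
  have i3 : Integrable (fun w : Slot M N => b₁ * slotLoad w ^ k₁ + b₂ * slotLoad w ^ k₂
    + b₃ * slotLoad w ^ k₃) P.toMeasure := i2.add j3
  have i4 : Integrable (fun w : Slot M N =>
      ∑ a, v a * (1 - if w.upd.sync a.1 a.2 then 1 else 0)) P.toMeasure :=
    integrable_finsetSum _ fun a _ => (iS a).const_mul _
  have i5 : Integrable (fun w : Slot M N => c₀
      + c₁ * ∑ n, y n * ((routed w.arr w.choice n : ℝ) - w.serv n)) P.toMeasure := i0.add i1
  have i6 : Integrable (fun w : Slot M N => c₀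
      + c₁ * ∑ n, y n * ((routed w.arr w.choice n : ℝ) - w.serv n)
      + (b₁ * slotLoad w ^ k₁ + b₂ * slotLoad w ^ k₂ + b₃ * slotLoad w ^ k₃)) P.toMeasure :=
    i5.add i3
  refine (add_le_add (expect_ofReal_le_integral (fun w => hV _) hle (i6.add i4)) le_rfl).trans ?_
  rw [← ENNReal.ofReal_add (integral_nonneg_of_ae
    (ae_of_support fun w hw => (hV _).trans (hle w hw))) hf]
  refine ENNReal.ofReal_le_ofReal (le_trans ?_ hU)
  refine add_le_add ?_ le_rfl
  rw [integral_add i6 i4, integral_add i5 i3, integral_add i0 i1, integral_add i2 j3,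
    integral_add j1 j2, integral_finsetSum _ fun a _ => (iS a).const_mul _]
  simp only [integral_const_mul]
  rw [eY]
  simp only [integral_const, probReal_univ, smul_eq_mul, one_mul]
  gcongr
  · exact bJ k₁
  · exact bJ k₂
  · exact bJ k₃
  · exact hv _
  · exact bS _

/-- Lyapunov function for the moments of the distance of the queues from the diagonal. -/
noncomputable def perpLyapunov (K : ℝ) (t : ℕ) (z : State M N) : ℝ :=
  ‖queuePerp z‖ ^ (2 * t + 2) + K * ∑ a : Fin M × Fin N, estError z a.1 a.2 ^ (2 * t + 1)

theorem perpLyapunov_nonneg {K : ℝ} (hK : 0 ≤ K) (t : ℕ) (z : State M N) :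
    0 ≤ perpLyapunov K t z := by
  unfold perpLyapunov
  have h : 0 ≤ ∑ a : Fin M × Fin N, estError z a.1 a.2 ^ (2 * t + 1) :=
    Finset.sum_nonneg fun a _ => pow_nonneg (estError_nonneg z a.1 a.2) _
  positivity

theorem estError_pow_next_le {κ C : ℝ} {r : ℕ} (hr : r ≠ 0) (hC : 0 ≤ C)
    (hκ : ∀ e J : ℝ, 0 ≤ e → 0 ≤ J → (e + J) ^ r ≤ (1 + κ) * e ^ r + C * J ^ r) {w : Slot M N}
    (hw : w ∈ (slotLaw arrival service pol z).support) (a : Fin M × Fin N) :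
    estError (nextState z w) a.1 a.2 ^ r
      ≤ (1 + κ) * estError z a.1 a.2 ^ r * (1 - if w.upd.sync a.1 a.2 then 1 else 0)
        + C * slotLoad w ^ r := by
  have h := estError_next_le hw a.1 a.2
  have hJ := slotLoad_nonneg w
  refine (pow_le_pow_left₀ (estError_nonneg _ _ _) h r).trans ?_
  split_ifs with hs
  · rw [zero_pow hr]
    have : 0 ≤ C * slotLoad w ^ r := by positivity
    linarith
  · simpa using hκ _ _ (estError_nonneg z a.1 a.2) hJ

theorem perpLyapunov_next_le (hN : 0 < N) {K κ C : ℝ} (hK : 0 ≤ K) (hC : 0 ≤ C) {t : ℕ}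
    (hκ : ∀ e J : ℝ, 0 ≤ e → 0 ≤ J →
      (e + J) ^ (2 * t + 1) ≤ (1 + κ) * e ^ (2 * t + 1) + C * J ^ (2 * t + 1))
    {w : Slot M N} (hw : w ∈ (slotLaw arrival service pol z).support) :
    perpLyapunov K t (nextState z w) ≤ ‖queuePerp z‖ ^ (2 * t + 2)
      + ((t + 1) * ‖queuePerp z‖ ^ (2 * t) * 2)
        * ∑ n, ((z.queue n : ℝ) - queueMean z) * ((routed w.arr w.choice n : ℝ) - w.serv n)
      + (((t + 1 + (t + 1) ^ 2 * 9 ^ t) * ‖queuePerp z‖ ^ (2 * t)) * slotLoad w ^ 2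
        + ((t + 1) ^ 2 * 9 ^ t) * slotLoad w ^ (2 * t + 2)
        + (K * (M * N * C)) * slotLoad w ^ (2 * t + 1))
      + ∑ a : Fin M × Fin N, (K * ((1 + κ) * estError z a.1 a.2 ^ (2 * t + 1)))
          * (1 - if w.upd.sync a.1 a.2 then 1 else 0) := by
  have h1 := even_pow_le_of_abs_sub_le (norm_nonneg (queuePerp z))
    (norm_nonneg (queuePerp (nextState z w))) (abs_norm_queuePerp_sub_le hN z w) t
  have h2 := norm_queuePerp_sq_next_le hN z w
  have h3 := mul_le_mul_of_nonneg_left h2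
    (show (0 : ℝ) ≤ (t + 1) * ‖queuePerp z‖ ^ (2 * t) by positivity)
  have h4 : K * ∑ a : Fin M × Fin N, estError (nextState z w) a.1 a.2 ^ (2 * t + 1)
      ≤ ∑ a : Fin M × Fin N, (K * ((1 + κ) * estError z a.1 a.2 ^ (2 * t + 1)))
          * (1 - if w.upd.sync a.1 a.2 then 1 else 0)
        + (K * (M * N * C)) * slotLoad w ^ (2 * t + 1) := by
    rw [Finset.mul_sum]
    have h5 := Finset.sum_le_sum fun a (_ : a ∈ Finset.univ) =>
      mul_le_mul_of_nonneg_left (estError_pow_next_le (by omega) hC hκ hw a) hK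
    refine h5.trans (le_of_eq ?_)
    simp only [mul_add, Finset.sum_add_distrib, Finset.sum_const, Finset.card_univ,
      Fintype.card_prod, Fintype.card_fin, nsmul_eq_mul, Nat.cast_mul]
    congr 1
    · exact Finset.sum_congr rfl fun a _ => by ring
    · ring
  unfold perpLyapunov
  linarith

/-- Young's inequality moves each cross term into a small multiple of `x ^ (2 * t + 1)`, which uses
half of `η₀`, and a multiple of `e i ^ (2 * t + 1)`. The value of `K` makes the error contraction `K
* (p / 2)` pay exactly for the latter. -/
theorem perp_bound_algebra {ι : Type*} [Fintype ι] {x η₀ c b γ p q K : ℝ} {t : ℕ} {e : ι → ℝ}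
    (hx : 0 ≤ x) (he : ∀ i, 0 ≤ e i) (hc : 0 ≤ c) (hb : 0 ≤ b) (hγ : 0 < γ)
    (hγη : (c * Fintype.card ι + b) * γ ≤ η₀ / 2) (hp : 0 < p)
    (hK : K = 2 * (c * γ⁻¹ ^ (2 * t)) / p) :
    x ^ (2 * t) * (-η₀ * x + c * ∑ i, e i + b)
        + ∑ i, K * ((1 + p / 2) * e i ^ (2 * t + 1)) * (1 - p) + q + η₀ / 2 * x ^ (2 * t + 1)
      ≤ K * ∑ i, e i ^ (2 * t + 1) + (b * γ⁻¹ ^ (2 * t) + q) := by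
  have h1 : x ^ (2 * t) * (c * ∑ i, e i)
      ≤ c * (Fintype.card ι * (γ * x ^ (2 * t + 1)) + γ⁻¹ ^ (2 * t) * ∑ i, e i ^ (2 * t + 1)) := by
    have : x ^ (2 * t) * (c * ∑ i, e i) = c * ∑ i, x ^ (2 * t) * e i := by
      rw [← Finset.mul_sum]
      ring
    rw [this]
    gcongr
    refine (Finset.sum_le_sum fun i _ => pow_mul_le hγ hx (he i) (2 * t)).trans (le_of_eq ?_)
    rw [Finset.sum_add_distrib, Finset.sum_const, Finset.card_univ, nsmul_eq_mul,
      Finset.mul_sum]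
  have h2 : x ^ (2 * t) * b ≤ b * (γ * x ^ (2 * t + 1) + γ⁻¹ ^ (2 * t)) := by
    have := mul_le_mul_of_nonneg_left (pow_mul_le hγ hx zero_le_one (2 * t)) hb
    simp only [mul_one, one_pow] at this
    linarith
  have h3 : (c * Fintype.card ι + b) * γ * x ^ (2 * t + 1) ≤ η₀ / 2 * x ^ (2 * t + 1) := by
    gcongr
  set S := ∑ i, e i ^ (2 * t + 1) with hS
  have hS0 : 0 ≤ S := Finset.sum_nonneg fun i _ => pow_nonneg (he i) _
  have h4 : ∑ i, K * ((1 + p / 2) * e i ^ (2 * t + 1)) * (1 - p)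
      = K * S * ((1 + p / 2) * (1 - p)) := by
    rw [hS, Finset.mul_sum, Finset.sum_mul]
    exact Finset.sum_congr rfl fun i _ => by ring
  have hK0 : 0 ≤ K := by rw [hK]; positivity
  -- Growth by `1 + p / 2` still leaves a contraction: `(1 + p/2) * (1 - p) = 1 - p/2 - p²/2`.
  have h5 : K * S * ((1 + p / 2) * (1 - p)) ≤ K * S * (1 - p / 2) := by
    gcongr
    nlinarith
  have h6 : K * S * (p / 2) = c * γ⁻¹ ^ (2 * t) * S := by
    rw [hK]
    field_simp
  have h7 : x ^ (2 * t) * (-η₀ * x) = -η₀ * x ^ (2 * t + 1) := by ring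
  rw [h4, mul_add, mul_add, h7]
  linarith

theorem exists_perp_drift (hN : 0 < N) (hθ₁ : 0 < θ₁) (hθ₂ : 0 < θ₂) (hδ : 0 < δ) (hp : 0 < p)
    (hrate : ∀ n, 0 < serviceRate service n)
    (htail : ∀ n, expect (service n) (fun s => ENNReal.ofReal (Real.exp (θ₂ * (s : ℝ))))
      ≤ ENNReal.ofReal D₂) (M : ℕ) (D₁ : ℝ) (t : ℕ) :
    ∃ K η C : ℝ, 0 ≤ K ∧ 0 < η ∧ 0 ≤ C ∧
      ∀ (ε : ℝ) (arrival : PMF (Fin M → ℕ)) (pol : Policy M N), 0 < ε →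
        ε ≤ totalServiceRate service / 2 → ε ≤ δ * totalServiceRate service / 4 →
        IsArrivalLaw service θ₁ D₁ ε arrival →
        (∀ m, IsDeltaTilted arrival service pol δ m) →
        UpdatesWithProb arrival service pol p → ∀ z, Reachable arrival service pol z →
        expect (transition arrival service pol z) (fun z => ENNReal.ofReal (perpLyapunov K t z))
          + ENNReal.ofReal (η * ‖queuePerp z‖ ^ (2 * t + 1))
          ≤ ENNReal.ofReal (perpLyapunov K t z) + ENNReal.ofReal C := by
  have hμ : 0 < totalServiceRate service := totalServiceRate_pos hN hrate
  have hN' : (0 : ℝ) < N := by exact_mod_cast hN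
  set B := loadMoment N θ₁ θ₂ D₁ D₂ with hB
  have hB0 : ∀ k, 0 ≤ B k := loadMoment_nonneg N θ₁ θ₂ D₁ D₂
  obtain ⟨C₁, hC₁, hκ⟩ := exists_add_pow_le (show 0 < p / 2 by positivity) (2 * t + 1)
  set η₀ : ℝ := (t + 1) * (δ * totalServiceRate service / (2 * N)) with hη₀
  have hη₀pos : 0 < η₀ := by positivity
  set c : ℝ := (t + 1) * (2 * (1 + 2 * δ) * totalServiceRate service) with hc
  have hc0 : 0 ≤ c := by positivity
  set b : ℝ := (t + 1 + (t + 1) ^ 2 * 9 ^ t) * B 2 with hb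
  have hb0 : 0 ≤ b := by have := hB0 2; positivity
  -- The added 1 keeps the denominator positive.
  set γ : ℝ := η₀ / 2 / (c * Fintype.card (Fin M × Fin N) + b + 1) with hγ
  have hγ0 : 0 < γ := by positivity
  have hγη : (c * Fintype.card (Fin M × Fin N) + b) * γ ≤ η₀ / 2 := by
    rw [hγ, ← mul_div_assoc, div_le_iff₀ (by positivity)]
    nlinarith
  set K : ℝ := 2 * (c * γ⁻¹ ^ (2 * t)) / p with hK
  have hK0 : 0 ≤ K := by positivity
  set q : ℝ := (t + 1) ^ 2 * 9 ^ t * B (2 * t + 2) + K * (M * N * C₁) * B (2 * t + 1) with hq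
  have hq0 : 0 ≤ q := by
    have h1 := hB0 (2 * t + 1)
    have h2 := hB0 (2 * t + 2)
    positivity
  refine ⟨K, η₀ / 2, b * γ⁻¹ ^ (2 * t) + q, hK0, by positivity, by positivity, ?_⟩
  intro ε arrival pol hε hε₁ hε₂ harr htilt hupd z hz
  set x := ‖queuePerp z‖ with hx
  have hx0 : 0 ≤ x := norm_nonneg _
  have h2 := perp_mean_drift_le hN hrate hδ hθ₁ hε hε₁ hε₂ harr htilt hz
  have h3 := perp_bound_algebra (q := q) (e := fun a : Fin M × Fin N => estError z a.1 a.2) hx0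
    (fun a => estError_nonneg z a.1 a.2) hc0 hb0 hγ0 hγη hp hK
  have h4 := mul_le_mul_of_nonneg_left h2 (show (0 : ℝ) ≤ (t + 1) * x ^ (2 * t) by positivity)
  rw [← ENNReal.ofReal_add (perpLyapunov_nonneg hK0 t z) (by positivity)]
  refine expect_next_le hθ₁ hθ₂ harr htail hupd hz (perpLyapunov_nonneg hK0 t)
    (b₁ := (t + 1 + (t + 1) ^ 2 * 9 ^ t) * x ^ (2 * t)) (b₂ := (t + 1) ^ 2 * 9 ^ t)
    (b₃ := K * (M * N * C₁)) (k₁ := 2) (k₂ := 2 * t + 2) (k₃ := 2 * t + 1)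
    (v := fun a => K * ((1 + p / 2) * estError z a.1 a.2 ^ (2 * t + 1)))
    (by positivity) (by positivity) (by positivity)
    (fun a => by have := estError_nonneg z a.1 a.2; positivity)
    (fun w hw => perpLyapunov_next_le hN hK0 hC₁ hκ hw) (by positivity) ?_
  rw [← hB, ← hx]
  unfold perpLyapunov
  rw [← hx]
  have e1 : x ^ (2 * t) * (-η₀ * x + c * ∑ a : Fin M × Fin N, estError z a.1 a.2 + b)
      = (t + 1) * x ^ (2 * t) * (-(δ * totalServiceRate service / (2 * N)) * x
      + 2 * (1 + 2 * δ) * totalServiceRate service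
        * ∑ a : Fin M × Fin N, estError z a.1 a.2)
      + (t + 1 + (t + 1) ^ 2 * 9 ^ t) * x ^ (2 * t) * B 2 := by
    rw [hη₀, hc, hb]
    ring
  rw [e1] at h3
  linarith

/-- Lyapunov function for the existence of a steady state. -/
noncomputable def queueLyapunov (K : ℝ) (z : State M N) : ℝ :=
  ∑ n, (z.queue n : ℝ) ^ 2 + K * ∑ a : Fin M × Fin N, estError z a.1 a.2

theorem queueLyapunov_nonneg {K : ℝ} (hK : 0 ≤ K) (z : State M N) : 0 ≤ queueLyapunov K z := by
  unfold queueLyapunov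
  have h : 0 ≤ ∑ a : Fin M × Fin N, estError z a.1 a.2 :=
    Finset.sum_nonneg fun a _ => estError_nonneg z a.1 a.2
  positivity

/-- The vanishing third load power only fits the shape required by `expect_next_le`. -/
theorem queueLyapunov_next_le {K : ℝ} (hK : 0 ≤ K) {w : Slot M N}
    (hw : w ∈ (slotLaw arrival service pol z).support) :
    queueLyapunov K (nextState z w) ≤ ∑ n, (z.queue n : ℝ) ^ 2
      + 2 * ∑ n, (z.queue n : ℝ) * ((routed w.arr w.choice n : ℝ) - w.serv n)
      + (1 * slotLoad w ^ 2 + (K * (M * N)) * slotLoad w ^ 1 + 0 * slotLoad w ^ 0)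
      + ∑ a : Fin M × Fin N, (K * estError z a.1 a.2)
          * (1 - if w.upd.sync a.1 a.2 then 1 else 0) := by
  have h1 := sum_nextQueue_sq_le z w
  have h4 : K * ∑ a : Fin M × Fin N, estError (nextState z w) a.1 a.2
      ≤ ∑ a : Fin M × Fin N, (K * estError z a.1 a.2)
          * (1 - if w.upd.sync a.1 a.2 then 1 else 0)
        + (K * (M * N)) * slotLoad w ^ 1 := by
    rw [Finset.mul_sum]
    have h5 := Finset.sum_le_sum fun a (_ : a ∈ Finset.univ) =>
      mul_le_mul_of_nonneg_left (estError_pow_next_le (κ := 0) (C := 1) one_ne_zero zero_le_one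
        (fun e J _ _ => by simp) hw a) hK
    simp only [pow_one] at h5
    refine h5.trans (le_of_eq ?_)
    simp only [mul_add, Finset.sum_add_distrib, Finset.sum_const, Finset.card_univ,
      Fintype.card_prod, Fintype.card_fin, nsmul_eq_mul, Nat.cast_mul]
    congr 1
    · exact Finset.sum_congr rfl fun a _ => by ring
    · ring
  have h6 : ∑ n, ((nextState z w).queue n : ℝ) ^ 2 = ∑ n, (nextQueue z w n : ℝ) ^ 2 := rfl
  unfold queueLyapunov
  rw [h6]
  linarith

theorem exists_queue_drift (hN : 0 < N) (hθ₁ : 0 < θ₁) (hθ₂ : 0 < θ₂) (hδ : 0 < δ) (hp : 0 < p)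
    (hrate : ∀ n, 0 < serviceRate service n)
    (htail : ∀ n, expect (service n) (fun s => ENNReal.ofReal (Real.exp (θ₂ * (s : ℝ))))
      ≤ ENNReal.ofReal D₂) (hε : 0 < ε) (harr : IsArrivalLaw service θ₁ D₁ ε arrival)
    (htilt : ∀ m, IsDeltaTilted arrival service pol δ m)
    (hupd : UpdatesWithProb arrival service pol p) :
    ∃ K C : ℝ, 0 ≤ K ∧ 0 ≤ C ∧ ∀ z, Reachable arrival service pol z →
      expect (transition arrival service pol z) (fun z => ENNReal.ofReal (queueLyapunov K z))
        + ENNReal.ofReal (∑ a : Fin M × Fin N, estError z a.1 a.2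
          + 2 * ε / totalServiceRate service * ∑ n, (z.queue n : ℝ) * serviceRate service n)
        ≤ ENNReal.ofReal (queueLyapunov K z) + ENNReal.ofReal C := by
  have hμ : 0 < totalServiceRate service := totalServiceRate_pos hN hrate
  set B := loadMoment N θ₁ θ₂ D₁ D₂ with hB
  have hB0 : ∀ k, 0 ≤ B k := loadMoment_nonneg N θ₁ θ₂ D₁ D₂
  set c : ℝ := 2 * (1 + 2 * δ) * totalServiceRate service with hc
  have hc0 : 0 ≤ c := by positivity
  -- The mean error decrease is `K * p = c + 1`: `c` pays for the inexact estimates and 1 remains as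
  -- drift.
  set K : ℝ := (c + 1) / p with hK
  have hK0 : 0 ≤ K := by positivity
  have hC0 : 0 ≤ B 2 + K * (M * N) * B 1 := by
    have h1 := hB0 1
    have h2 := hB0 2
    positivity
  refine ⟨K, B 2 + K * (M * N) * B 1, hK0, hC0, ?_⟩
  intro z hz
  -- Taking `i = j` discards the gain from the tilt; with `τ = 0` the slack supplies the drift in
  -- the queues.
  have h2 := mean_drift_le hN hrate hδ hθ₁ hε harr htilt hz 0 ⟨0, hN⟩ ⟨0, hN⟩
  simp only [sub_zero, sub_self, mul_zero, zero_add] at h2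
  have hE : 0 ≤ ∑ a : Fin M × Fin N, estError z a.1 a.2 :=
    Finset.sum_nonneg fun a _ => estError_nonneg z a.1 a.2
  have hQ : 0 ≤ ∑ n, (z.queue n : ℝ) * serviceRate service n :=
    Finset.sum_nonneg fun n _ => mul_nonneg (by positivity) (hrate n).le
  rw [← ENNReal.ofReal_add (queueLyapunov_nonneg hK0 z) hC0]
  refine expect_next_le hθ₁ hθ₂ harr htail hupd hz (queueLyapunov_nonneg hK0)
    (v := fun a => K * estError z a.1 a.2)
    zero_le_one (by positivity) le_rfl
    (fun a => mul_nonneg hK0 (estError_nonneg z a.1 a.2))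
    (fun w hw => queueLyapunov_next_le hK0 hw) (by positivity) ?_
  rw [← hB]
  unfold queueLyapunov
  have h5 : ∑ a : Fin M × Fin N, K * estError z a.1 a.2 * (1 - p)
      = K * ∑ a : Fin M × Fin N, estError z a.1 a.2
        - (c + 1) * ∑ a : Fin M × Fin N, estError z a.1 a.2 := by
    rw [← Finset.sum_mul, ← Finset.mul_sum, hK]
    field_simp
  rw [h5]
  have h6 : 2 * ε / totalServiceRate service
      = 2 * (ε / totalServiceRate service) := by ring
  rw [h6]
  linarith

/-- The slack term bounds the queues, and the error term then bounds the estimates, so both are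
needed for finiteness. -/
theorem finite_sublevel (hε : 0 < ε) (hN : 0 < N) (hrate : ∀ n, 0 < serviceRate service n)
    (k : ℕ) :
    {z : State M N | ENNReal.ofReal (∑ a : Fin M × Fin N, estError z a.1 a.2
      + 2 * ε / totalServiceRate service * ∑ n, (z.queue n : ℝ) * serviceRate service n)
        ≤ k}.Finite := by
  have hμ : 0 < totalServiceRate service := totalServiceRate_pos hN hrate
  set c := 2 * ε / totalServiceRate service with hc
  have hc0 : 0 < c := by positivity
  set b : Fin N → ℕ := fun n => ⌈(k : ℝ) / (c * serviceRate service n)⌉₊ with hb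
  have hinj : Function.Injective fun z : State M N => (z.queue, z.est) := by
    rintro ⟨a, b⟩ ⟨c, d⟩ h
    simpa using h
  refine Set.Finite.of_finite_image (f := fun z : State M N => (z.queue, z.est)) ?_ hinj.injOn
  refine ((Set.finite_Iic b).prod
    (Set.finite_Iic (fun (_ : Fin M) (n : Fin N) => b n + k))).subset ?_
  rintro _ ⟨z, hz, rfl⟩
  have hE : ∀ a : Fin M × Fin N, estError z a.1 a.2
      ≤ ∑ a : Fin M × Fin N, estError z a.1 a.2 := fun a =>
    Finset.single_le_sum (f := fun a : Fin M × Fin N => estError z a.1 a.2)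
      (fun a _ => estError_nonneg z a.1 a.2) (Finset.mem_univ a)
  have hQ : ∀ n, (z.queue n : ℝ) * serviceRate service n
      ≤ ∑ n, (z.queue n : ℝ) * serviceRate service n := fun n =>
    Finset.single_le_sum (f := fun n => (z.queue n : ℝ) * serviceRate service n)
      (fun n _ => mul_nonneg (by positivity) (hrate n).le) (Finset.mem_univ n)
  have hE0 : 0 ≤ ∑ a : Fin M × Fin N, estError z a.1 a.2 :=
    Finset.sum_nonneg fun a _ => estError_nonneg z a.1 a.2
  have hQ0 : 0 ≤ ∑ n, (z.queue n : ℝ) * serviceRate service n :=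
    Finset.sum_nonneg fun n _ => mul_nonneg (by positivity) (hrate n).le
  have hk : ∑ a : Fin M × Fin N, estError z a.1 a.2
      + c * ∑ n, (z.queue n : ℝ) * serviceRate service n ≤ k := by
    have : ENNReal.ofReal _ ≤ (k : ℝ≥0∞) := hz
    rw [← ENNReal.ofReal_natCast, ENNReal.ofReal_le_ofReal_iff (by positivity)] at this
    exact this
  have hcQ : 0 ≤ c * ∑ n, (z.queue n : ℝ) * serviceRate service n := by positivity
  have hqb : ∀ n, z.queue n ≤ b n := by
    intro n
    have h1 : (z.queue n : ℝ) ≤ (k : ℝ) / (c * serviceRate service n) := by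
      rw [le_div_iff₀ (mul_pos hc0 (hrate n))]
      have := mul_le_mul_of_nonneg_left (hQ n) hc0.le
      linarith
    exact_mod_cast h1.trans (Nat.le_ceil _)
  refine ⟨fun n => hqb n, fun m n => ?_⟩
  have h1 := hE (m, n)
  have h2 : (z.est m n : ℝ) - z.queue n ≤ estError z m n := by
    rw [estError, abs_sub_comm]
    exact le_abs_self _
  have h3 : (z.queue n : ℝ) ≤ b n := by exact_mod_cast hqb n
  have h4 : (z.est m n : ℝ) ≤ (b n : ℝ) + k := by
    simp only at h1
    linarith
  show z.est m n ≤ b n + k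
  exact_mod_cast h4

end Lyapunov

/-! ### Moment bounds in steady state and conclusion. -/

section Main

variable {M N : ℕ} {arrival : PMF (Fin M → ℕ)} {service : Fin N → PMF ℕ} {pol : Policy M N}

theorem reachable_next (z : State M N) (hz : Reachable arrival service pol z) :
    ∀ y ∈ (transition arrival service pol z).support, Reachable arrival service pol y :=
  fun _ hy => Relation.ReflTransGen.tail hz hy

/-- The drift with `t = r` controls the moment of order `2 * r + 1`, and `x ^ r ≤ 1 + x ^ (2 * r +
1)`. -/
theorem expect_perp_pow_le {π : PMF (State M N)} {K η C : ℝ} (hη : 0 < η) {r : ℕ}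
    (hdrift : ∀ z, Reachable arrival service pol z →
      expect (transition arrival service pol z) (fun z => ENNReal.ofReal (perpLyapunov K r z))
        + ENNReal.ofReal (η * ‖queuePerp z‖ ^ (2 * r + 1))
        ≤ ENNReal.ofReal (perpLyapunov K r z) + ENNReal.ofReal C)
    (hC : 0 ≤ C) (hπ : IsSteadyState arrival service pol π) :
    expect π (fun z => ENNReal.ofReal (‖queuePerp z‖ ^ r)) ≤ ENNReal.ofReal (1 + η⁻¹ * C) := by
  have h := expect_stationary_le (f := fun z => ENNReal.ofReal (η * ‖queuePerp z‖ ^ (2 * r + 1)))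
    reachable_next (fun z => ENNReal.ofReal_ne_top)
    (fun z => ENNReal.ofReal_ne_top) hdrift hπ.2 hπ.1
  have h1 : expect π (fun z => ENNReal.ofReal (‖queuePerp z‖ ^ r))
      ≤ expect π (fun z => 1 + ENNReal.ofReal η⁻¹
        * ENNReal.ofReal (η * ‖queuePerp z‖ ^ (2 * r + 1))) := by
    refine expect_mono π fun z _ => ?_
    rw [← ENNReal.ofReal_mul (by positivity), ← ENNReal.ofReal_one,
      ← ENNReal.ofReal_add zero_le_one (by positivity), inv_mul_cancel_left₀ hη.ne']
    refine ENNReal.ofReal_le_ofReal ?_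
    have hx := norm_nonneg (queuePerp z)
    rcases le_total ‖queuePerp z‖ 1 with hc | hc
    · have h2 := pow_le_one₀ hx hc (n := r)
      have h3 : 0 ≤ ‖queuePerp z‖ ^ (2 * r + 1) := by positivity
      linarith
    · have h2 := pow_le_pow_right₀ hc (show r ≤ 2 * r + 1 by omega)
      linarith
  refine h1.trans ?_
  rw [expect_add, expect_const, expect_const_mul, ENNReal.ofReal_add zero_le_one (by positivity),
    ENNReal.ofReal_mul (by positivity), ENNReal.ofReal_one]
  gcongr

end Main

end LED

theorem proposition1 {M N : ℕ} (service : Fin N → PMF ℕ) (θ₁ θ₂ D₁ D₂ δ p : ℝ)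
    (hθ₁ : 0 < θ₁) (hθ₂ : 0 < θ₂) (hδ : 0 < δ) (hp : 0 < p)
    (hrate : ∀ n, 0 < LED.serviceRate service n)
    (htail : ∀ n, LED.expect (service n) (fun s => ENNReal.ofReal (Real.exp (θ₂ * (s : ℝ))))
      ≤ ENNReal.ofReal D₂) :
    ∃ ε₀ : ℝ, 0 < ε₀ ∧ ∃ L : ℕ → ℝ, ∀ ε ∈ Set.Ioo 0 ε₀,
      ∀ (arrival : PMF (Fin M → ℕ)) (pol : LED.Policy M N),
        LED.IsArrivalLaw service θ₁ D₁ ε arrival →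
        (∀ m, LED.IsDeltaTilted arrival service pol δ m) →
        LED.UpdatesWithProb arrival service pol p →
        (∃ π, LED.IsSteadyState arrival service pol π) ∧
        ∀ π, LED.IsSteadyState arrival service pol π → ∀ r : ℕ,
          LED.expect π (fun z => ENNReal.ofReal (‖LED.queuePerp z‖ ^ r))
            ≤ ENNReal.ofReal (L r) := by
  rcases Nat.eq_zero_or_pos N with rfl | hN
  -- Without servers the arrival rate would be `-ε < 0`, so there is no such system.
  · refine ⟨1, one_pos, fun _ => 0, fun ε hε arrival pol harr => ?_⟩
    have h := harr.rate
    have h0 : LED.totalServiceRate service = 0 := by simp [LED.totalServiceRate]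
    have h1 : 0 ≤ LED.totalArrivalRate arrival := ENNReal.toReal_nonneg
    have h2 := hε.1
    linarith
  have hμ : 0 < LED.totalServiceRate service := LED.totalServiceRate_pos hN hrate
  choose K η C hK hη hC hdrift using
    LED.exists_perp_drift hN hθ₁ hθ₂ hδ hp hrate htail M D₁
  refine ⟨min (LED.totalServiceRate service / 2) (δ * LED.totalServiceRate service / 4),
    by positivity, fun r => 1 + (η r)⁻¹ * C r, ?_⟩
  intro ε hε arrival pol harr htilt hupd
  have hε₁ := hε.2.le.trans (min_le_left _ _)
  have hε₂ := hε.2.le.trans (min_le_right _ _)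
  constructor
  · obtain ⟨K₀, C₀, -, -, hd⟩ :=
      LED.exists_queue_drift hN hθ₁ hθ₂ hδ hp hrate htail hε.1 harr htilt hupd
    exact LED.exists_stationary LED.reachable_next (fun z => ENNReal.ofReal_ne_top)
      ENNReal.ofReal_ne_top hd (LED.finite_sublevel hε.1 hN hrate) Relation.ReflTransGen.refl
  · intro π hπ r
    exact LED.expect_perp_pow_le (hη r)
      (hdrift r ε arrival pol hε.1 hε₁ hε₂ harr htilt hupd) (hC r) hπ
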